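/- Let $G$ be a finite simple undirected graph and let $H$ assign to every vertex $x\in V(G)$ a finite nonempty set $H(x)$ of non-negative integers. Write $mH(x)=\min H(x)$, $MH(x)=\max H(x)$, and, for $S\subseteq V(G)$, $mH(S)=\sum_{x\in S}mH(x)$ and $MH(S)=\sum_{x\in S}MH(x)$. Assume that every gap in $H(x)$ has size one, i.e. $(*)$ for every vertex $x$ and every integer $i$ with $mH(x)\le i\le MH(x)$: if $i\notin H(x)$, then $i+1\in H(x)$. For a graph $K$ and a map $L$ from $V(K)$ to the finite sets of integers, an $L$-factor of $K$ is a spanning subgraph $F$ of $K$ with $d_F(x)\in L(x)$ for all $x\in V(K)$. The total deficiency of $G$ with respect to $H$ is $$def_H(G)=\min_F\sum_{x\in V(G)}\operatorname{dist}(d_F(x),H(x)),\qquad \operatorname{dist}(d,A)=\min_{a\in A}|d-a|,$$ where the first minimum is over all spanning subgraphs $F$ of $G$. For disjoint $S,T\subseteq V(G)$ and a connected component $K$ of $G-S-T$, let $H_{(S,T)|K}(u)=\{\,i-|E_G(u,T)| : i\in H(u)\,\}$ for $u\in V(K)$, where $E_G(u,T)$ is the set of edges of $G$ joining $u$ to $T$.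 Let $\tau_H(S,T)$ be the number of components $K$ of $G-S-T$ that have no $H_{(S,T)|K}$-factor. Then $$def_H(G)=\max_{S,T\subseteq V(G),\ S\cap T=\emptyset}\Bigl(\tau_H(S,T)-\sum_{x\in T}d_{G-S}(x)-MH(S)+mH(T)\Bigr).$$ Moreover, $G$ has an $H$-factor if and only if for every pair of disjoint sets $S,T\subseteq V(G)$ $$\tau_H(S,T)-\sum_{x\in T}d_{G-S}(x)-MH(S)+mH(T)\le 0.$$ -/

import Mathlib

namespace HFactor

variable {V : Type*}

/-- The degree of `v` in `G` (the number of neighbours), as an integer. -/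
noncomputable def deg (G : SimpleGraph V) (v : V) : ℤ :=
  ((G.neighborSet v).ncard : ℤ)

theorem deg_eq_degree (G : SimpleGraph V) (v : V) [Fintype (G.neighborSet v)] :
    deg G v = (G.degree v : ℤ) := by
  rw [deg, Set.ncard_eq_toFinset_card', SimpleGraph.degree, SimpleGraph.neighborFinset]

/-- The number of edges of `G` joining the vertex `u` to the set `Y`, that is `|E_G(u, Y)|`. -/
noncomputable def edgesTo (G : SimpleGraph V) (u : V) (Y : Set V) : ℤ :=
  ((G.neighborSet u ∩ Y).ncard : ℤ)

/-- The degree of `x` in `G - S`, for a vertex `x` outside `S`; see `degDelete_eq_deg_induce`. -/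
noncomputable def degDelete (G : SimpleGraph V) (S : Set V) (x : V) : ℤ :=
  ((G.neighborSet x \ S).ncard : ℤ)

theorem degDelete_eq_deg_induce (G : SimpleGraph V) (S : Set V) (x : V) (hx : x ∈ Sᶜ) :
    degDelete G S x = deg (G.induce Sᶜ) ⟨x, hx⟩ := by
  unfold degDelete deg
  congr 1
  rw [← Set.ncard_image_of_injective _ (Subtype.val_injective (p := fun a => a ∈ Sᶜ))]
  congr 1
  ext y
  simp [and_comm]

/-- A spanning subgraph `F` of `G` is an `H`-factor if `d_F(x) ∈ H(x)` for every vertex `x`. -/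
def IsFactor (G : SimpleGraph V) (H : V → Finset ℤ) (F : SimpleGraph V) : Prop :=
  F ≤ G ∧ ∀ x, deg F x ∈ H x

/-- `G` has an `H`-factor. -/
def HasFactor (G : SimpleGraph V) (H : V → Finset ℤ) : Prop :=
  ∃ F : SimpleGraph V, IsFactor G H F

/-- `mH(x)`, the least element of `H(x)`. -/
def minH (H : V → Finset ℤ) (hne : ∀ x, (H x).Nonempty) (x : V) : ℤ :=
  (H x).min' (hne x)

/-- `MH(x)`, the greatest element of `H(x)`. -/
def maxH (H : V → Finset ℤ) (hne : ∀ x, (H x).Nonempty) (x : V) : ℤ :=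
  (H x).max' (hne x)

/-- Every gap of every `H(x)` has size one. -/
def GapOne (H : V → Finset ℤ) (hne : ∀ x, (H x).Nonempty) : Prop :=
  ∀ x, ∀ i : ℤ, minH H hne x ≤ i → i ≤ maxH H hne x → i ∉ H x → i + 1 ∈ H x

/-- The distance of the integer `d` from the finite nonempty set `A`. -/
def distTo (d : ℤ) (A : Finset ℤ) (hA : A.Nonempty) : ℕ :=
  A.inf' hA fun a => (d - a).natAbs

/-- The deficiency `def_H[F]` of a spanning subgraph `F`. -/
noncomputable def subgraphDeficiency [Fintype V] (H : V → Finset ℤ)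
    (hne : ∀ x, (H x).Nonempty) (F : SimpleGraph V) : ℕ :=
  ∑ x, distTo (deg F x) (H x) (hne x)

/-- The total deficiency `def_H(G)`: the minimum of `def_H[F]` over all spanning subgraphs `F`
of `G` (the set is a nonempty set of natural numbers, so its infimum is attained). -/
noncomputable def totalDeficiency [Fintype V] (G : SimpleGraph V) (H : V → Finset ℤ)
    (hne : ∀ x, (H x).Nonempty) : ℕ :=
  sInf {n : ℕ | ∃ F : SimpleGraph V, F ≤ G ∧ n = subgraphDeficiency H hne F}

/-- The modified prescription `H_{(X,Y)}(u) = H(u) - |E_G(u, Y)|`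
(it does not depend on `X` except through its domain `V(G) - X - Y`). -/
noncomputable def modified (G : SimpleGraph V) (H : V → Finset ℤ) (Y : Set V) (u : V) :
    Finset ℤ :=
  (H u).image fun i => i - edgesTo G u Y

/-- The graph `G - S - T`. -/
def deleted (G : SimpleGraph V) (S T : Set V) : SimpleGraph ↥((S ∪ T)ᶜ) :=
  G.induce (S ∪ T)ᶜ

/-- The prescription `H_{(S,T)|K}` on the vertices of a component `K` of `G - S - T`. -/
noncomputable def modifiedOn (G : SimpleGraph V) (H : V → Finset ℤ) (S T : Set V)
    (K : (deleted G S T).ConnectedComponent) : K → Finset ℤ :=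
  fun u => modified G H T u.1.1

/-- `τ_H(S, T)`: the number of components `K` of `G - S - T` without an `H_{(S,T)|K}`-factor. -/
noncomputable def tau (G : SimpleGraph V) (H : V → Finset ℤ) (S T : Set V) : ℤ :=
  ({K : (deleted G S T).ConnectedComponent |
      ¬ HasFactor K.toSimpleGraph (modifiedOn G H S T K)}.ncard : ℤ)

/-- `τ_H(S, T) - ∑_{x ∈ T} d_{G-S}(x) - MH(S) + mH(T)`. -/
noncomputable def lovaszValue (G : SimpleGraph V) (H : V → Finset ℤ)
    (hne : ∀ x, (H x).Nonempty) (S T : Finset V) : ℤ :=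
  tau G H S T - ∑ x ∈ T, degDelete G S x - ∑ x ∈ S, maxH H hne x + ∑ x ∈ T, minH H hne x

end HFactor

/-! The vectors `d_F - h`, with `F` a spanning subgraph of `G` and `h x ∈ H x`, form a jump system
because the gaps of `H` have size one (`isJumpSystem_degreeSystem`). Their least `ℓ¹`-norm is
`def_H(G)`. For each pair `S, T` the same construction is applied to `G - S - T`, with the
prescription reduced by the edges to `T`; to its least norm one adds `weight`, the part of the
Lovász value without `tau`.

Moving a vertex into `S` or `T` never raises this sum. The norm of any member is at least `tau`,
since a factorless component carries a nonzero entry (`tau_le_l1`). So every Lovász value is at most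
the deficiency.

For equality, look at the signs of a coordinate `x` over the members of least norm. If `x` is
positive at one of them and negative at none, `x` goes to `S`; with the signs exchanged it goes to
`T`. By `IsJumpSystem.l1_sub_le` the sum does not fall, and the process stops after finitely many
moves. In the end every coordinate is either always zero or takes both signs, hence only the values
`-1, 0, 1` (`IsJumpSystem.mul_le_one`). Then adjacent vertices are never both nonzero
(`IsEdgeExtension.exclusive`), and this passes along walks (`IsJumpSystem.exclusive_trans`). So each
component carries at most one unit of norm, and none if it has a factor: the least norm is at most
`tau`. -/

namespace HFactor

set_option linter.unusedSectionVars false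

/-! ### Jump systems and their members of least norm -/

section JumpSystem

open scoped Classical

variable {V : Type*}

/-- The entries of `z'` on `X` have the signs of those of `z` and are at least as large. -/
def Dominates (X : Set V) (z z' : V → ℤ) : Prop :=
  ∀ v ∈ X, (0 < z v → z v ≤ z' v) ∧ (z v < 0 → z' v ≤ z v)

theorem Dominates.trans {X : Set V} {z z' z'' : V → ℤ} (h : Dominates X z z')
    (h' : Dominates X z' z'') : Dominates X z z'' := by
  intro v hv
  have := h v hv
  have := h' v hv
  omega

variable [Fintype V]

/-- The `ℓ¹`-norm of an integer vector. -/
def l1 (z : V → ℤ) : ℤ := ∑ x, |z x|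

theorem l1_nonneg (z : V → ℤ) : 0 ≤ l1 z :=
  Finset.sum_nonneg fun _ _ => abs_nonneg _

theorem l1_add_single (z : V → ℤ) (v : V) (a : ℤ) :
    l1 (z + Pi.single v a) = l1 z - |z v| + |z v + a| := by
  unfold l1
  rw [← Finset.add_sum_erase _ _ (Finset.mem_univ v),
    ← Finset.add_sum_erase (a := v) _ (fun x => |z x|) (Finset.mem_univ v)]
  have : ∑ x ∈ Finset.univ.erase v, |(z + Pi.single v a : V → ℤ) x| =
      ∑ x ∈ Finset.univ.erase v, |z x| := by
    refine Finset.sum_congr rfl fun x hx => ?_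
    simp [Pi.single_eq_of_ne (Finset.ne_of_mem_erase hx)]
  rw [this]
  simp
  ring

theorem l1_add_single_single (z : V → ℤ) {v w : V} (h : w ≠ v) (a b : ℤ) :
    l1 (z + Pi.single v a + Pi.single w b) =
      l1 z - |z v| + |z v + a| - |z w| + |z w + b| := by
  rw [l1_add_single, l1_add_single]
  simp [Pi.single_eq_of_ne h]

/-- Jump systems: a unit step from one member towards another one can be completed to a member
by at most one further unit step towards the second member. -/
def IsJumpSystem (J : Set (V → ℤ)) : Prop :=
  ∀ z ∈ J, ∀ q ∈ J, ∀ v : V, ∀ σ : ℤ, (σ = 1 ∨ σ = -1) → σ * z v < σ * q v →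
    z + Pi.single v σ ∈ J ∨ ∃ w : V, ∃ τ : ℤ, (τ = 1 ∨ τ = -1) ∧
      τ * (z + Pi.single v σ : V → ℤ) w < τ * q w ∧ z + Pi.single v σ + Pi.single w τ ∈ J

/-- The members of least norm. -/
def IsOptimal (J : Set (V → ℤ)) (z : V → ℤ) : Prop :=
  z ∈ J ∧ ∀ q ∈ J, l1 z ≤ l1 q

theorem IsOptimal.of_le {J : Set (V → ℤ)} {z q : V → ℤ} (hz : IsOptimal J z) (hq : q ∈ J)
    (h : l1 q ≤ l1 z) : IsOptimal J q :=
  ⟨hq, fun p hp => h.trans (hz.2 p hp)⟩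

theorem IsOptimal.l1_eq {J : Set (V → ℤ)} {z q : V → ℤ} (hz : IsOptimal J z)
    (hq : IsOptimal J q) : l1 z = l1 q :=
  le_antisymm (hz.2 q hq.1) (hq.2 z hz.1)

theorem exists_isOptimal {J : Set (V → ℤ)} (h : J.Nonempty) : ∃ z, IsOptimal J z := by
  obtain ⟨z, hz, hmin⟩ := (measure fun z : V → ℤ => (l1 z).toNat).wf.has_min J h
  refine ⟨z, hz, fun q hq => ?_⟩
  have : ¬ (l1 q).toNat < (l1 z).toNat := hmin q hq
  have := l1_nonneg z
  have := l1_nonneg q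
  omega

/-- A step that decreases the norm of an optimal member is followed by one that increases it. -/
theorem IsJumpSystem.step {J : Set (V → ℤ)} (hJ : IsJumpSystem J) {z q : V → ℤ}
    (hz : IsOptimal J z) (hq : q ∈ J) (v : V) {σ : ℤ} (hσ : σ = 1 ∨ σ = -1)
    (hpos : 0 < σ * z v) (hlt : σ * q v < σ * z v) :
    (σ * z v = 1 ∧ σ * q v < 0 ∧ IsOptimal J (z + Pi.single v (-2 * σ))) ∨
    ∃ w, w ≠ v ∧ ∃ τ : ℤ, (τ = 1 ∨ τ = -1) ∧ 0 ≤ τ * z w ∧ τ * z w < τ * q w ∧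
      IsOptimal J (z + Pi.single v (-σ) + Pi.single w τ) := by
  rcases hJ z hz.1 q hq v (-σ) (by omega) (by linarith) with h | ⟨w, τ, hτ, hlt', h⟩
  · exfalso
    have h1 := hz.2 _ h
    rw [l1_add_single] at h1
    rcases hσ with rfl | rfl <;> simp only [abs] at h1 <;> grind
  · by_cases hw : w = v
    · subst hw
      left
      simp only [Pi.add_apply, Pi.single_eq_same] at hlt'
      have e : τ = -σ := by
        rcases hσ with rfl | rfl <;> rcases hτ with rfl | rfl <;> grind
      subst e
      have e2 : z + Pi.single w (-σ) + Pi.single w (-σ) = z + Pi.single w (-2 * σ) := by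
        rw [add_assoc, ← Pi.single_add]; congr 2; ring
      rw [e2] at h
      have h1 := hz.2 _ h
      rw [l1_add_single] at h1
      -- Two steps inward at the same coordinate must not lower the norm, so the entry was `σ` and
      -- has become `-σ`.
      have h2 : σ * z w = 1 := by
        rcases hσ with rfl | rfl <;> grind
      refine ⟨h2, ?_, hz.of_le h ?_⟩
      · rcases hσ with rfl | rfl <;> grind
      · rw [l1_add_single]
        rcases hσ with rfl | rfl <;> grind
    · right
      simp only [Pi.add_apply, Pi.single_eq_of_ne hw, add_zero] at hlt'
      have h1 := hz.2 _ h
      rw [l1_add_single_single _ hw] at h1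
      refine ⟨w, hw, τ, hτ, ?_, hlt', hz.of_le h ?_⟩
      · rcases hσ with rfl | rfl <;> rcases hτ with rfl | rfl <;> grind
      · rw [l1_add_single_single _ hw]
        rcases hσ with rfl | rfl <;> rcases hτ with rfl | rfl <;> grind

/-- Every change made by `IsJumpSystem.step` goes towards `u`, so the distance drops. The inward
change is at `v ∉ X`; the compensating one points away from zero, so it respects `Dominates`. -/
theorem IsJumpSystem.exists_closer {J : Set (V → ℤ)} (hJ : IsJumpSystem J) {X : Set V}
    {z u : V → ℤ} (hz : IsOptimal J z) (hu : u ∈ J) {v : V} (hv : v ∉ X) {σ : ℤ}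
    (hσ : σ = 1 ∨ σ = -1) (hpos : 0 < σ * z v) (hlt : σ * u v < σ * z v) :
    ∃ z', IsOptimal J z' ∧ l1 (z' - u) < l1 (z - u) ∧ Dominates X z z' := by
  rcases hJ.step hz hu v hσ hpos hlt with ⟨h1, h2, h3⟩ | ⟨w, hw, τ, hτ, h1, h2, h3⟩
  · refine ⟨_, h3, ?_, ?_⟩
    · rw [show z + Pi.single v (-2 * σ) - u = z - u + Pi.single v (-2 * σ) by abel,
        l1_add_single]
      simp only [Pi.sub_apply]
      rcases hσ with rfl | rfl <;> grind
    · intro x hx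
      have : x ≠ v := fun h => hv (h ▸ hx)
      simp [Pi.single_eq_of_ne this]
  · refine ⟨_, h3, ?_, ?_⟩
    · rw [show z + Pi.single v (-σ) + Pi.single w τ - u =
        z - u + Pi.single v (-σ) + Pi.single w τ by abel, l1_add_single_single _ hw]
      simp only [Pi.sub_apply]
      rcases hσ with rfl | rfl <;> rcases hτ with rfl | rfl <;> grind
    · intro x hx
      have : x ≠ v := fun h => hv (h ▸ hx)
      by_cases hxw : x = w
      · subst hxw
        simp only [Pi.add_apply, Pi.single_eq_of_ne this, Pi.single_eq_same]
        rcases hτ with rfl | rfl <;> constructor <;> intro <;> omega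
      · simp [Pi.single_eq_of_ne this, Pi.single_eq_of_ne hxw]

/-- Where the two members differ outside `X`, one of them can be pulled inwards, towards the other,
by `exists_closer`. The distance decreases until they agree off `X`, while entries on `X` keep their
signs and never shrink. -/
theorem IsJumpSystem.exists_eq_off {J : Set (V → ℤ)} (hJ : IsJumpSystem J) (X : Set V)
    {z u : V → ℤ} (hz : IsOptimal J z) (hu : IsOptimal J u) :
    ∃ z' u', IsOptimal J z' ∧ IsOptimal J u' ∧ (∀ v ∉ X, z' v = u' v) ∧
      Dominates X z z' ∧ Dominates X u u' := by
  induction hn : (l1 (z - u)).toNat using Nat.strong_induction_on generalizing z u with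
  | _ n ih =>
    by_cases hall : ∀ v ∉ X, z v = u v
    · exact ⟨z, u, hz, hu, hall, fun v _ => ⟨fun _ => le_rfl, fun _ => le_rfl⟩,
        fun v _ => ⟨fun _ => le_rfl, fun _ => le_rfl⟩⟩
    push Not at hall
    obtain ⟨v, hv, hne⟩ := hall
    have key : ∃ σ : ℤ, (σ = 1 ∨ σ = -1) ∧ ((0 < σ * z v ∧ σ * u v < σ * z v) ∨
        (0 < σ * u v ∧ σ * z v < σ * u v)) := by
      by_cases h : 0 < z v ∨ 0 < u v
      · exact ⟨1, Or.inl rfl, by omega⟩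
      · exact ⟨-1, Or.inr rfl, by omega⟩
    obtain ⟨σ, hσ, ⟨h1, h2⟩ | ⟨h1, h2⟩⟩ := key
    · obtain ⟨z₁, hz₁, hd, hdom⟩ := hJ.exists_closer hz hu.1 hv hσ h1 h2
      have := l1_nonneg (z₁ - u)
      obtain ⟨z', u', h3, h4, h5, h6, h7⟩ := ih _ (by omega) hz₁ hu rfl
      exact ⟨z', u', h3, h4, h5, hdom.trans h6, h7⟩
    · obtain ⟨u₁, hu₁, hd, hdom⟩ := hJ.exists_closer hu hz.1 hv hσ h1 h2
      have hsymm : ∀ a b : V → ℤ, l1 (a - b) = l1 (b - a) := fun a b =>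
        Finset.sum_congr rfl fun x _ => abs_sub_comm _ _
      rw [hsymm, hsymm u] at hd
      have := l1_nonneg (z - u₁)
      obtain ⟨z', u', h3, h4, h5, h6, h7⟩ := ih _ (by omega) hz hu₁ rfl
      exact ⟨z', u', h3, h4, h5, h6, hdom.trans h7⟩

/-- A coordinate that takes both signs at optimal members is at most one in absolute value. -/
theorem IsJumpSystem.mul_le_one {J : Set (V → ℤ)} (hJ : IsJumpSystem J) {z u : V → ℤ}
    (hz : IsOptimal J z) (hu : IsOptimal J u) {x : V} {σ : ℤ} (hσ : σ = 1 ∨ σ = -1)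
    (hux : σ * u x < 0) : σ * z x ≤ 1 := by
  by_contra! hlt
  obtain ⟨z', u', hz', hu', heq, hdz, hdu⟩ := hJ.exists_eq_off {x} hz hu
  have h1 := hdz x rfl
  have h2 := hdu x rfl
  have h3 : 2 ≤ σ * z' x := by rcases hσ with rfl | rfl <;> omega
  have h4 : σ * u' x < 0 := by rcases hσ with rfl | rfl <;> omega
  -- Off `x` the two members agree, so no other coordinate can compensate, and a flip at `x` would
  -- need the entry `σ`.
  rcases hJ.step hz' hu'.1 x hσ (by omega) (by omega) with ⟨h, -⟩ | ⟨w, hw, τ, hτ, h5, h6, -⟩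
  · omega
  · rw [heq w hw] at h6
    exact lt_irrefl _ h6

/-- Pulling `q` inwards at `v` saves one unit of norm, and the completing step costs at most one. If
that step is at `x`, it lowers `|q x|`: the norm then drops by two in all, which pays for the growth
of `2 * (σ * q x)`. -/
theorem IsJumpSystem.exists_closer_of_opposite {J : Set (V → ℤ)} (hJ : IsJumpSystem J) {x v : V}
    {σ ρ : ℤ} (hσ : σ = 1 ∨ σ = -1) (hρ : ρ = 1 ∨ ρ = -1) {z q : V → ℤ} (hz : z ∈ J)
    (hzx : 0 < σ * z x) (hq : q ∈ J) (hqx : σ * q x < 0) (hv : v ≠ x) (h1 : 0 < ρ * q v)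
    (h2 : ρ * z v < ρ * q v) :
    ∃ q' ∈ J, l1 (z - q') < l1 (z - q) ∧ σ * q' x ≤ 0 ∧
      l1 q' + 2 * (σ * q' x) ≤ l1 q + 2 * (σ * q x) := by
  rcases hJ q hq z hz v (-ρ) (by omega) (by linarith) with h | ⟨w, τ, hτ, hlt', h⟩
  · have hd : l1 (z - (q + Pi.single v (-ρ))) < l1 (z - q) := by
      rw [show z - (q + Pi.single v (-ρ)) = z - q + Pi.single v ρ by
        rw [Pi.single_neg]; abel, l1_add_single]
      simp only [Pi.sub_apply]
      rcases hρ with rfl | rfl <;> grind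
    refine ⟨_, h, hd, ?_, ?_⟩
    · simpa [Pi.single_eq_of_ne hv.symm] using hqx.le
    · rw [l1_add_single]
      simp only [Pi.add_apply, Pi.single_eq_of_ne hv.symm, add_zero]
      rcases hρ with rfl | rfl <;> grind
  · by_cases hw : w = v
    · subst hw
      simp only [Pi.add_apply, Pi.single_eq_same] at hlt'
      obtain ⟨rfl, hge⟩ : τ = -ρ ∧ 2 ≤ ρ * q w - ρ * z w := by
        rcases hρ with rfl | rfl <;> rcases hτ with rfl | rfl <;> grind
      rw [add_assoc, ← Pi.single_add] at h
      have hd : l1 (z - (q + Pi.single w (-ρ + -ρ))) < l1 (z - q) := by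
        rw [show z - (q + Pi.single w (-ρ + -ρ)) = z - q + Pi.single w (ρ + ρ) by
          rw [← neg_add, Pi.single_neg]; abel, l1_add_single]
        simp only [Pi.sub_apply]
        rcases hρ with rfl | rfl <;> grind
      refine ⟨_, h, hd, ?_, ?_⟩
      · simpa [Pi.single_eq_of_ne hv.symm] using hqx.le
      · rw [l1_add_single]
        simp only [Pi.add_apply, Pi.single_eq_of_ne hv.symm, add_zero]
        rcases hρ with rfl | rfl <;> grind
    · simp only [Pi.add_apply, Pi.single_eq_of_ne hw, add_zero] at hlt'
      have hd : l1 (z - (q + Pi.single v (-ρ) + Pi.single w τ)) < l1 (z - q) := by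
        rw [show z - (q + Pi.single v (-ρ) + Pi.single w τ) =
          z - q + Pi.single v ρ + Pi.single w (-τ) by
            rw [Pi.single_neg, Pi.single_neg]; abel, l1_add_single_single _ hw]
        simp only [Pi.sub_apply]
        rcases hρ with rfl | rfl <;> rcases hτ with rfl | rfl <;> grind
      by_cases hwx : w = x
      · subst hwx
        refine ⟨_, h, hd, ?_, ?_⟩
        · simp only [Pi.add_apply, Pi.single_eq_of_ne hw, add_zero, Pi.single_eq_same]
          rcases hσ with rfl | rfl <;> rcases hτ with rfl | rfl <;> omega
        · rw [l1_add_single_single _ hw]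
          simp only [Pi.add_apply, Pi.single_eq_of_ne hw, add_zero, Pi.single_eq_same]
          rcases hσ with rfl | rfl <;> rcases hτ with rfl | rfl <;>
            rcases hρ with rfl | rfl <;> grind
      · refine ⟨_, h, hd, ?_, ?_⟩
        · simpa [Pi.single_eq_of_ne hv.symm, Pi.single_eq_of_ne (Ne.symm hwx)] using hqx.le
        · rw [l1_add_single_single _ hw]
          simp only [Pi.add_apply, Pi.single_eq_of_ne hv.symm,
            Pi.single_eq_of_ne (Ne.symm hwx), add_zero]
          rcases hτ with rfl | rfl <;> rcases hρ with rfl | rfl <;> grind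

/-- If `σ z x ≥ 0` for all optimal `z`, with strict inequality for one of them, then the members
with `σ q x ≤ 0` have a large norm. -/
theorem IsJumpSystem.l1_sub_le {J : Set (V → ℤ)} (hJ : IsJumpSystem J) {x : V} {σ : ℤ}
    (hσ : σ = 1 ∨ σ = -1) (hall : ∀ z, IsOptimal J z → 0 ≤ σ * z x) {z q : V → ℤ}
    (hz : IsOptimal J z) (hzx : 0 < σ * z x) (hq : q ∈ J) (hqx : σ * q x ≤ 0) :
    l1 z - 2 * (σ * q x) ≤ l1 q := by
  by_contra! hlt
  induction hn : (l1 (z - q)).toNat using Nat.strong_induction_on generalizing z q with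
  | _ n ih =>
    have hqx' : σ * q x < 0 := by
      rcases hqx.lt_or_eq with h | h
      · exact h
      · rw [h] at hlt
        have := hz.2 q hq
        omega
    -- In a closest counterexample `z` cannot be pulled towards `q` off `x`, because the new optimal
    -- member would still be positive in direction `σ` at `x`.
    have hzone : ∀ v ≠ x, ∀ ρ : ℤ, (ρ = 1 ∨ ρ = -1) → 0 < ρ * z v → ρ * z v ≤ ρ * q v := by
      intro v hv ρ hρ hpos
      by_contra! hlt'
      obtain ⟨z₁, hz₁, hd, hdom⟩ := hJ.exists_closer (X := {x}) hz hq hv hρ hpos hlt'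
      have := l1_nonneg (z₁ - q)
      have hdx := hdom x rfl
      refine ih _ (by omega) hz₁ ?_ hq hqx ?_ rfl
      · rcases hσ with rfl | rfl <;> omega
      · rwa [← hz.l1_eq hz₁]
    have heq : ∀ v ≠ x, z v = q v := by
      by_contra! hne
      obtain ⟨v, hv, hne⟩ := hne
      obtain ⟨ρ, hρ, h1, h2⟩ : ∃ ρ : ℤ, (ρ = 1 ∨ ρ = -1) ∧ 0 < ρ * q v ∧ ρ * z v < ρ * q v := by
        have h1 := hzone v hv 1 (Or.inl rfl)
        have h2 := hzone v hv (-1) (Or.inr rfl)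
        by_cases h : 0 < q v
        · exact ⟨1, Or.inl rfl, by omega⟩
        · exact ⟨-1, Or.inr rfl, by omega⟩
      obtain ⟨q', hq', hd, hx', hl⟩ :=
        hJ.exists_closer_of_opposite hσ hρ hz.1 hzx hq hqx' hv h1 h2
      have := l1_nonneg (z - q')
      exact ih _ (by omega) hz hzx hq' hx' (by omega) rfl
    -- Now `z` and `q` differ only at `x`, so the step flips `x` and yields an optimal member
    -- excluded by `hall`.
    rcases hJ.step hz hq x hσ hzx (by omega) with ⟨h1, -, h3⟩ | ⟨w, hw, τ, hτ, h5, h6, -⟩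
    · have := hall _ h3
      simp only [Pi.add_apply, Pi.single_eq_same] at this
      rcases hσ with rfl | rfl <;> omega
    · rw [heq w hw] at h6
      exact lt_irrefl _ h6

end JumpSystem

/-! ### Nonzero coordinates of optimal members -/

section OptimalCoordinates

open scoped Classical

variable {V : Type*}

/-- The vector `r`, changed by `a` at `x` and by `b` at `y`. -/
noncomputable def shift (r : V → ℤ) (x y : V) (a b : ℤ) : V → ℤ :=
  r + Pi.single x a + Pi.single y b

theorem shift_comm (r : V → ℤ) (x y : V) (a b : ℤ) : shift r x y a b = shift r y x b a := by
  unfold shift; abel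

theorem shift_add_left (r : V → ℤ) (x y : V) (a b c : ℤ) :
    shift r x y a b + Pi.single x c = shift r x y (a + c) b := by
  unfold shift; rw [Pi.single_add]; abel

theorem shift_add_right (r : V → ℤ) (x y : V) (a b c : ℤ) :
    shift r x y a b + Pi.single y c = shift r x y a (b + c) := by
  unfold shift; rw [Pi.single_add]; abel

theorem shift_eq {r z : V → ℤ} {x y : V} (hxy : x ≠ y) {a b : ℤ} (hx : r x + a = z x)
    (hy : r y + b = z y) (h : ∀ v, v ≠ x → v ≠ y → r v = z v) : shift r x y a b = z := by
  funext v
  unfold shift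
  by_cases hvx : v = x
  · subst hvx; simp [Pi.single_eq_of_ne hxy, hx]
  by_cases hvy : v = y
  · subst hvy; simp [Pi.single_eq_of_ne hvx, hy]
  simp [Pi.single_eq_of_ne hvx, Pi.single_eq_of_ne hvy, h v hvx hvy]

theorem shift_shift (r : V → ℤ) (x y : V) (a b c d : ℤ) :
    shift (shift r x y a b) x y c d = shift r x y (a + c) (b + d) := by
  unfold shift; rw [Pi.single_add, Pi.single_add]; abel

/-- The jump axiom inside the plane through `r` in directions `x, y`: all other coordinates agree,
so the completing step cannot leave the plane. -/
theorem IsJumpSystem.shift_jump {J : Set (V → ℤ)} (hJ : IsJumpSystem J) {r : V → ℤ} {x y : V}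
    (hxy : x ≠ y) {a b c d σ : ℤ} (h₁ : shift r x y a b ∈ J) (h₂ : shift r x y c d ∈ J)
    (hσ : σ = 1 ∨ σ = -1) (hlt : σ * a < σ * c) :
    shift r x y (a + σ) b ∈ J ∨ (σ * (a + σ) < σ * c ∧ shift r x y (a + σ + σ) b ∈ J) ∨
      (b < d ∧ shift r x y (a + σ) (b + 1) ∈ J) ∨
      (d < b ∧ shift r x y (a + σ) (b + -1) ∈ J) := by
  have hx : ∀ a b, shift r x y a b x = r x + a := by
    intro a b; simp [shift, Pi.single_eq_of_ne hxy]
  have hy : ∀ a b, shift r x y a b y = r y + b := by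
    intro a b; simp [shift, Pi.single_eq_of_ne hxy.symm]
  have ho : ∀ v, v ≠ x → v ≠ y → ∀ a b, shift r x y a b v = r v := by
    intro v h1 h2 a b; simp [shift, Pi.single_eq_of_ne h1, Pi.single_eq_of_ne h2]
  rcases hJ _ h₁ _ h₂ x σ hσ (by rw [hx, hx]; rcases hσ with rfl | rfl <;> omega) with
    h | ⟨w, τ, hτ, h1, h⟩
  · left; rwa [shift_add_left] at h
  · right
    rw [shift_add_left] at h1 h
    by_cases hwx : w = x
    · subst hwx
      left
      rw [shift_add_left] at h
      rw [hx, hx] at h1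
      have : τ = σ := by
        rcases hτ with rfl | rfl <;> rcases hσ with rfl | rfl <;> omega
      subst this
      exact ⟨by rcases hτ with rfl | rfl <;> omega, h⟩
    by_cases hwy : w = y
    · subst hwy
      right
      rw [shift_add_right] at h
      rw [hy, hy] at h1
      rcases hτ with rfl | rfl
      · exact Or.inl ⟨by omega, h⟩
      · exact Or.inr ⟨by omega, h⟩
    · rw [ho w hwx hwy, ho w hwx hwy] at h1
      exact absurd h1 (lt_irrefl _)

/-- `J` arises from the jump system `J₀` by adding an optional edge between `x` and `y`. -/
structure IsEdgeExtension (J₀ J : Set (V → ℤ)) (x y : V) : Prop where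
  ne : x ≠ y
  jump₀ : IsJumpSystem J₀
  jump : IsJumpSystem J
  mem_of_mem : ∀ z ∈ J₀, z ∈ J
  add_mem : ∀ z ∈ J₀, shift z x y 1 1 ∈ J
  mem_or : ∀ z ∈ J, z ∈ J₀ ∨ shift z x y (-1) (-1) ∈ J₀

/-- In plane coordinates, both `J₀` and `J₀ + (1,1)` avoid the points of norm below two. This forces
`(1,1)` and `(-2,-2)` into `J₀`. Jumping between them in direction `y` produces `(1,-1)` and
`(-2,0)`, and from `(1,-1)` no jump in direction `x` towards `(-2,0)` is left. -/
theorem IsEdgeExtension.not_shift_mem {J₀ J : Set (V → ℤ)} {x y : V}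
    (h : IsEdgeExtension J₀ J x y) {r : V → ℤ}
    (hJ : ∀ a b, shift r x y a b ∈ J → 2 ≤ |a| + |b|) (h₁ : shift r x y 1 1 ∈ J)
    (h₂ : shift r x y (-1) (-1) ∈ J) : False := by
  have hJ₁ : ∀ a b, shift r x y a b ∈ J₀ → 2 ≤ |a + 1| + |b + 1| := by
    intro a b hab
    have := h.add_mem _ hab
    rw [shift_shift] at this
    exact hJ _ _ this
  have hJ₀ := fun a b hab => hJ a b (h.mem_of_mem _ hab)
  have k1 : shift r x y 1 1 ∈ J₀ := by
    rcases h.mem_or _ h₁ with h3 | h3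
    · exact h3
    · rw [shift_shift] at h3
      have := hJ₀ _ _ h3
      norm_num at this
  have k2 : shift r x y (-2) (-2) ∈ J₀ := by
    rcases h.mem_or _ h₂ with h3 | h3
    · have := hJ₁ _ _ h3
      norm_num at this
    · rw [shift_shift] at h3
      exact h3
  have k3 : shift r x y 1 (-1) ∈ J₀ := by
    rw [shift_comm] at k1 k2 ⊢
    rcases h.jump₀.shift_jump h.ne.symm k1 k2 (Or.inr rfl) (by norm_num) with
      h3 | ⟨-, h3⟩ | ⟨h4, -⟩ | ⟨-, h3⟩
    · rw [shift_comm] at h3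
      have := hJ₀ _ _ h3
      norm_num at this
    · exact h3
    · norm_num at h4
    · rw [shift_comm] at h3
      have := hJ₀ _ _ h3
      norm_num at this
  have k4 : shift r x y (-2) 0 ∈ J₀ := by
    rw [shift_comm] at k1 k2 ⊢
    rcases h.jump₀.shift_jump h.ne.symm k2 k1 (Or.inl rfl) (by norm_num) with
      h3 | ⟨-, h3⟩ | ⟨-, h3⟩ | ⟨h4, -⟩
    · rw [shift_comm] at h3
      have := hJ₁ _ _ h3
      norm_num at this
    · exact h3
    · rw [shift_comm] at h3
      have := hJ₁ _ _ h3
      norm_num at this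
    · norm_num at h4
  rcases h.jump₀.shift_jump h.ne k3 k4 (Or.inr rfl) (by norm_num) with
    h3 | ⟨-, h3⟩ | ⟨-, h3⟩ | ⟨h4, -⟩
  · have := hJ₀ _ _ h3
    norm_num at this
  · have := hJ₁ _ _ h3
    norm_num at this
  · have := hJ₀ _ _ h3
    norm_num at this
  · norm_num at h4

variable [Fintype V]

theorem l1_sub_l1_eq_sum {z u : V → ℤ} (s : Finset V) (h : ∀ v ∉ s, z v = u v) :
    l1 z - l1 u = ∑ v ∈ s, (|z v| - |u v|) := by
  unfold l1
  rw [← Finset.sum_sub_distrib]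
  refine (Finset.sum_subset (Finset.subset_univ s) fun v _ hv => ?_).symm
  rw [h v hv, sub_self]

/-- No optimal member is nonzero at both `x` and `y`, or `x = y`. -/
def Exclusive (J : Set (V → ℤ)) (x y : V) : Prop :=
  x = y ∨ ∀ z, IsOptimal J z → z x ≠ 0 → z y = 0

/-- Otherwise some optimal `z` is nonzero at `x` and `w`, and some optimal `u` is nonzero at `y`.
Made equal off `{x, y, w}`, they carry norm two and norm one on that set, although optimal norms are
equal. -/
theorem IsJumpSystem.exclusive_trans {J : Set (V → ℤ)} (hJ : IsJumpSystem J)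
    (hsmall : ∀ z, IsOptimal J z → ∀ v, |z v| ≤ 1) {x y w : V}
    (hy : ∃ u, IsOptimal J u ∧ u y ≠ 0) (hxy : Exclusive J x y) (hyw : Exclusive J y w) :
    Exclusive J x w := by
  rcases hxy with rfl | hxy
  · exact hyw
  rcases hyw with rfl | hyw
  · exact Or.inr hxy
  by_cases hxw : x = w
  · exact Or.inl hxw
  refine Or.inr fun z hz hzx => by_contra fun hzw => ?_
  obtain ⟨u, hu, huy⟩ := hy
  obtain ⟨z', u', hz', hu', heq, hdz, hdu⟩ := hJ.exists_eq_off {x, y, w} hz hu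
  have h1 := hdz x (by simp)
  have h2 := hdz w (by simp)
  have h3 := hdu y (by simp)
  have hzx' : z' x ≠ 0 := by omega
  have hzw' : z' w ≠ 0 := by omega
  have huy' : u' y ≠ 0 := by omega
  have hzy' : z' y = 0 := hxy z' hz' hzx'
  have huw' : u' w = 0 := hyw u' hu' huy'
  have hux' : u' x = 0 := by_contra fun h => huy' (hxy u' hu' h)
  have hne1 : x ≠ y := fun h => hzx' (h ▸ hzy')
  have hne2 : y ≠ w := fun h => hzw' (h ▸ hzy')
  have hsum := l1_sub_l1_eq_sum (z := z') (u := u') {x, y, w}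
    (fun v hv => heq v (by simpa using hv))
  rw [Finset.sum_insert (by simp [hne1, hxw]), Finset.sum_pair hne2, hz'.l1_eq hu', hzy', huw',
    hux'] at hsum
  have h4 := hsmall u' hu' y
  have h5 := abs_pos.2 hzx'
  have h6 := abs_pos.2 hzw'
  simp only [abs_zero] at hsum
  omega

/-- Step from `z` at `x` towards `u`. A compensation at `y` would have to point away from zero and
also towards `-z y`, which is impossible, so `x` flips alone. -/
theorem IsJumpSystem.exists_flip {J : Set (V → ℤ)} (hJ : IsJumpSystem J)
    (hsmall : ∀ z, IsOptimal J z → ∀ v, |z v| ≤ 1) {x y : V} {z u : V → ℤ}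
    (hz : IsOptimal J z) (hu : IsOptimal J u) (heq : ∀ v, v ≠ x → v ≠ y → z v = u v)
    (hzx : z x ≠ 0) (hx : u x = -z x) (hy : u y = -z y) :
    ∃ z', IsOptimal J z' ∧ z' x = -z x ∧ ∀ v ≠ x, z' v = z v := by
  have hs := abs_le.1 (hsmall z hz x)
  rcases hJ.step hz hu.1 x (σ := z x) (by omega) (mul_self_pos.2 hzx)
    (by rw [hx]; nlinarith [mul_self_pos.2 hzx]) with ⟨-, -, h⟩ | ⟨w, hw, τ, hτ, h1, h2, -⟩
  · refine ⟨_, h, ?_, fun v hv => ?_⟩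
    · simp only [Pi.add_apply, Pi.single_eq_same]; ring
    · simp [Pi.single_eq_of_ne hv]
  · exfalso
    by_cases hwy : w = y
    · rw [hwy, hy] at h2
      rw [hwy] at h1
      linarith
    · rw [heq w hw hwy] at h2
      exact lt_irrefl _ h2

/-- Make the two members equal off `{x, y}`. Equality of norms leaves only `± z y` for the second
entry at `y`; in the bad case `exists_flip` changes the sign at `x` alone. -/
theorem IsJumpSystem.exists_neg_apply {J : Set (V → ℤ)} (hJ : IsJumpSystem J)
    (hsmall : ∀ z, IsOptimal J z → ∀ v, |z v| ≤ 1) {x y : V} (hxy : x ≠ y) {z u : V → ℤ}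
    (hz : IsOptimal J z) (hu : IsOptimal J u) (hzx : z x ≠ 0) (hzy : z y ≠ 0)
    (hux : u x = -z x) : ∃ z', IsOptimal J z' ∧ z' x = -z x ∧ z' y = z y := by
  obtain ⟨z', u', hz', hu', heq, hdz, hdu⟩ := hJ.exists_eq_off {x, y} hz hu
  have h1 := hdz x (by simp)
  have h2 := hdz y (by simp)
  have h3 := hdu x (by simp)
  have a1 := abs_le.1 (hsmall z hz x)
  have a2 := abs_le.1 (hsmall z hz y)
  have a3 := abs_le.1 (hsmall z' hz' x)
  have a4 := abs_le.1 (hsmall z' hz' y)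
  have a5 := abs_le.1 (hsmall u' hu' x)
  have a6 := abs_le.1 (hsmall u' hu' y)
  have e1 : z' x = z x := by omega
  have e2 : z' y = z y := by omega
  have e3 : u' x = - z x := by omega
  have hsum := l1_sub_l1_eq_sum (z := z') (u := u') {x, y}
    (fun v hv => heq v (by simpa using hv))
  rw [Finset.sum_pair hxy, hz'.l1_eq hu', e1, e2, e3, abs_neg] at hsum
  have e4 : |u' y| = |z y| := by linarith
  rcases abs_eq_abs.1 e4 with h | h
  · exact ⟨u', hu', e3, h⟩
  · obtain ⟨z'', h5, h6, h7⟩ := hJ.exists_flip hsmall (x := x) (y := y) hz' hu'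
      (fun v hx hy => heq v (by simp [hx, hy])) (by omega) (by omega) (by omega)
    exact ⟨z'', h5, by omega, by rw [h7 y hxy.symm]; exact e2⟩

theorem l1_shift {r : V → ℤ} {x y : V} (hxy : x ≠ y) (hx : r x = 0) (hy : r y = 0) (a b : ℤ) :
    l1 (shift r x y a b) = l1 r + |a| + |b| := by
  rw [shift, l1_add_single_single _ hxy.symm, hx, hy]
  simp

/-- A neighbour of a coordinate taking both signs is not always zero. -/
theorem IsEdgeExtension.exists_ne_zero {J₀ J : Set (V → ℤ)} {x y : V}
    (h : IsEdgeExtension J₀ J x y) (hsmall : ∀ z, IsOptimal J z → ∀ v, |z v| ≤ 1)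
    {z u : V → ℤ} (hz : IsOptimal J z) (hu : IsOptimal J u) (hzx : z x = 1) (hux : u x = -1) :
    ∃ w, IsOptimal J w ∧ w y ≠ 0 := by
  by_contra! hall
  obtain ⟨z', u', hz', hu', heq, hdz, hdu⟩ := h.jump.exists_eq_off {x} hz hu
  have h1 := hdz x rfl
  have h2 := hdu x rfl
  have a1 := abs_le.1 (hsmall z' hz' x)
  have a2 := abs_le.1 (hsmall u' hu' x)
  have b1 := hall z' hz'
  have b2 := hall u' hu'
  -- In the plane centred at `r`, `z'` is `(1,0)` and `u'` is `(-1,0)`. Since `y` always vanishes at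
  -- optimal members, `J` misses the origin and `(0,±1)`; this puts `(1,0)` and `(-2,-1)` into `J₀`,
  -- with no admissible jump from the first to the second.
  set r : V → ℤ := Function.update z' x 0 with hr
  have hrx : r x = 0 := by simp [hr]
  have hry : r y = 0 := by rw [hr, Function.update_of_ne h.ne.symm]; exact b1
  have ro : ∀ v, v ≠ x → r v = z' v := fun v hv => by rw [hr, Function.update_of_ne hv]
  have ez : shift r x y 1 0 = z' := shift_eq h.ne (by omega) (by omega) fun v hv _ => ro v hv
  have eu : shift r x y (-1) 0 = u' := shift_eq h.ne (by omega) (by omega)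
    fun v hv _ => (ro v hv).trans (heq v hv)
  have hl := fun a b => l1_shift h.ne hrx hry a b
  have hJ : ∀ a b, shift r x y a b ∈ J → 1 < |a| + |b| ∨ (|a| + |b| = 1 ∧ b = 0) := by
    intro a b hab
    have h3 := hz'.2 _ hab
    rw [← ez, hl, hl] at h3
    norm_num at h3
    rcases (show 1 ≤ |a| + |b| by linarith).lt_or_eq with h4 | h4
    · exact Or.inl h4
    · right
      refine ⟨h4.symm, ?_⟩
      have h5 := hall _ (hz'.of_le hab (by rw [← ez, hl, hl]; norm_num; linarith))
      simpa [shift, Pi.single_eq_of_ne h.ne.symm, hry] using h5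
  have hJ₁ : ∀ a b, shift r x y a b ∈ J₀ → shift r x y (a + 1) (b + 1) ∈ J := by
    intro a b hab
    have := h.add_mem _ hab
    rwa [shift_shift] at this
  have hJ₀ := fun a b hab => hJ a b (h.mem_of_mem _ hab)
  have k1 : shift r x y 1 0 ∈ J₀ := by
    rcases h.mem_or _ (ez ▸ hz'.1) with h3 | h3
    · exact h3
    · rw [shift_shift] at h3
      have := hJ₀ _ _ h3
      norm_num at this
  have k2 : shift r x y (-2) (-1) ∈ J₀ := by
    rcases h.mem_or _ (eu ▸ hu'.1) with h3 | h3
    · have := hJ _ _ (hJ₁ _ _ h3)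
      norm_num at this
    · rw [shift_shift] at h3
      exact h3
  rcases h.jump₀.shift_jump h.ne k1 k2 (Or.inr rfl) (by norm_num) with
    h3 | ⟨-, h3⟩ | ⟨h4, -⟩ | ⟨-, h3⟩
  · have := hJ₀ _ _ h3
    norm_num at this
  · have := hJ _ _ (hJ₁ _ _ h3)
    norm_num at this
  · norm_num at h4
  · have := hJ₀ _ _ h3
    norm_num at this

theorem IsEdgeExtension.false_of_isOptimal {J₀ J : Set (V → ℤ)} {x y : V}
    (h : IsEdgeExtension J₀ J x y) {p q : V → ℤ} (hp : IsOptimal J p) (hq : IsOptimal J q)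
    (hpx : p x = 1) (hpy : p y = 1) (hqx : q x = -1) (hqy : q y = -1)
    (heq : ∀ v, v ≠ x → v ≠ y → p v = q v) : False := by
  set r : V → ℤ := Function.update (Function.update p x 0) y 0 with hr
  have hrx : r x = 0 := by simp [hr, h.ne]
  have hry : r y = 0 := by simp [hr]
  have ro : ∀ v, v ≠ x → v ≠ y → r v = p v := fun v hv hv' => by
    rw [hr, Function.update_of_ne hv', Function.update_of_ne hv]
  have e1 : shift r x y 1 1 = p := shift_eq h.ne (by omega) (by omega) ro
  have e2 : shift r x y (-1) (-1) = q := shift_eq h.ne (by omega) (by omega)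
    fun v hv hv' => (ro v hv hv').trans (heq v hv hv')
  refine h.not_shift_mem (r := r) (fun a b hab => ?_) (e1 ▸ hp.1) (e2 ▸ hq.1)
  have h3 := hp.2 _ hab
  rw [← e1, l1_shift h.ne hrx hry, l1_shift h.ne hrx hry] at h3
  norm_num at h3
  linarith

theorem IsJumpSystem.exists_apply_eq {J : Set (V → ℤ)} (hJ : IsJumpSystem J)
    (hsmall : ∀ z, IsOptimal J z → ∀ v, |z v| ≤ 1) {x y : V} (hxy : x ≠ y)
    (hx : ∀ σ : ℤ, (σ = 1 ∨ σ = -1) → ∃ z, IsOptimal J z ∧ z x = σ) {z : V → ℤ}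
    (hz : IsOptimal J z) (hzx : z x ≠ 0) (hzy : z y ≠ 0) {σ : ℤ} (hσ : σ = 1 ∨ σ = -1) :
    ∃ z', IsOptimal J z' ∧ z' x = σ ∧ z' y = z y := by
  have hs := abs_le.1 (hsmall z hz x)
  by_cases h : z x = σ
  · exact ⟨z, hz, h, rfl⟩
  · obtain ⟨u, hu, hux⟩ := hx σ hσ
    obtain ⟨z', h1, h2, h3⟩ := hJ.exists_neg_apply hsmall hxy hz hu hzx hzy (by omega)
    exact ⟨z', h1, by omega, h3⟩

/-- Adjacent coordinates taking both signs are not simultaneously nonzero at optimal members. -/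
theorem IsEdgeExtension.exclusive {J₀ J : Set (V → ℤ)} {x y : V}
    (h : IsEdgeExtension J₀ J x y) (hsmall : ∀ z, IsOptimal J z → ∀ v, |z v| ≤ 1)
    (hx : ∀ σ : ℤ, (σ = 1 ∨ σ = -1) → ∃ z, IsOptimal J z ∧ z x = σ)
    (hy : ∀ σ : ℤ, (σ = 1 ∨ σ = -1) → ∃ z, IsOptimal J z ∧ z y = σ) : Exclusive J x y := by
  refine Or.inr fun z hz hzx => by_contra fun hzy => ?_
  -- The signs at `x` and `y` can be prescribed one after the other, so both `(1,1)` and `(-1,-1)`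
  -- occur.
  have hsign : ∀ σ : ℤ, (σ = 1 ∨ σ = -1) → ∃ p, IsOptimal J p ∧ p x = σ ∧ p y = σ := by
    intro σ hσ
    obtain ⟨z₁, hz₁, h1, h2⟩ := h.jump.exists_apply_eq hsmall h.ne hx hz hzx hzy hσ
    obtain ⟨z₂, hz₂, h3, h4⟩ := h.jump.exists_apply_eq hsmall h.ne.symm hy hz₁ (by omega)
      (by omega) hσ
    exact ⟨z₂, hz₂, by omega, h3⟩
  obtain ⟨p, hp, hpx, hpy⟩ := hsign 1 (Or.inl rfl)
  obtain ⟨q, hq, hqx, hqy⟩ := hsign (-1) (Or.inr rfl)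
  obtain ⟨z', u', hz', hu', heq, hdz, hdu⟩ := h.jump.exists_eq_off {x, y} hp hq
  have h1 := hdz x (by simp)
  have h2 := hdz y (by simp)
  have h3 := hdu x (by simp)
  have h4 := hdu y (by simp)
  have a1 := abs_le.1 (hsmall z' hz' x)
  have a2 := abs_le.1 (hsmall z' hz' y)
  have a3 := abs_le.1 (hsmall u' hu' x)
  have a4 := abs_le.1 (hsmall u' hu' y)
  exact h.false_of_isOptimal hz' hu' (by omega) (by omega) (by omega) (by omega)
    fun v hv hv' => heq v (by simp [hv, hv'])

end OptimalCoordinates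

/-! ### Degree vectors minus prescriptions form a jump system -/

section DegreeSystem

open scoped Classical

variable {V : Type*}

/-- The number of members of `F` incident with `x`. -/
noncomputable def incDeg (F : Finset (Sym2 V)) (x : V) : ℤ := ((F.filter fun e => x ∈ e).card : ℤ)

theorem incDeg_insert {F : Finset (Sym2 V)} {v w : V} (hvw : w ≠ v) (h : s(v, w) ∉ F) (x : V) :
    incDeg (insert s(v, w) F) x =
      incDeg F x + (Pi.single v 1 + Pi.single w 1 : V → ℤ) x := by
  unfold incDeg
  rw [Finset.filter_insert]
  by_cases hv : x = v
  · subst hv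
    rw [if_pos (by simp), Finset.card_insert_of_notMem (by simp [h])]
    simp [Pi.single_eq_of_ne hvw.symm]
  by_cases hw : x = w
  · subst hw
    rw [if_pos (by simp), Finset.card_insert_of_notMem (by simp [h])]
    simp [Pi.single_eq_of_ne hvw]
  rw [if_neg (by simp [hv, hw])]
  simp [Pi.single_eq_of_ne hv, Pi.single_eq_of_ne hw]

theorem incDeg_erase {F : Finset (Sym2 V)} {v w : V} (hvw : w ≠ v) (h : s(v, w) ∈ F) (x : V) :
    incDeg (F.erase s(v, w)) x =
      incDeg F x + (Pi.single v (-1) + Pi.single w (-1) : V → ℤ) x := by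
  have h1 := incDeg_insert hvw (Finset.notMem_erase s(v, w) F) x
  rw [Finset.insert_erase h] at h1
  rw [h1, Pi.single_neg, Pi.single_neg]
  simp only [Pi.add_apply, Pi.neg_apply]
  ring

/-- The degrees at `v` differ, so some edge at `v` lies in exactly one of the two sets, on the side
given by `σ`. Toggling it in `F` brings `F` closer to `F'`. -/
theorem exists_toggle {E F F' : Finset (Sym2 V)} (hE : ∀ e ∈ E, ¬ e.IsDiag) (hF : F ⊆ E)
    (hF' : F' ⊆ E) {v : V} {σ : ℤ} (hσ : σ = 1 ∨ σ = -1)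
    (hlt : σ * incDeg F v < σ * incDeg F' v) :
    ∃ F₁ ⊆ E, ∃ w, w ≠ v ∧
      (∀ x, incDeg F₁ x = incDeg F x + (Pi.single v σ + Pi.single w σ : V → ℤ) x) ∧
      (symmDiff F₁ F').card < (symmDiff F F').card := by
  have key : ∀ A B : Finset (Sym2 V), A ⊆ E → incDeg B v < incDeg A v →
      ∃ w, w ≠ v ∧ s(v, w) ∈ A ∧ s(v, w) ∉ B := by
    intro A B hA h
    unfold incDeg at h
    obtain ⟨e, he, he'⟩ := Finset.exists_mem_notMem_of_card_lt_card (by exact_mod_cast h)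
    rw [Finset.mem_filter] at he he'
    obtain ⟨w, rfl⟩ := Sym2.mem_iff_exists.1 he.2
    refine ⟨w, fun hw => ?_, he.1, fun hB => he' ⟨hB, he.2⟩⟩
    exact hE _ (hA he.1) (by rw [hw]; simp)
  rcases hσ with rfl | rfl
  · obtain ⟨w, hw, h1, h2⟩ := key F' F hF' (by omega)
    refine ⟨insert s(v, w) F, Finset.insert_subset (hF' h1) hF, w, hw, incDeg_insert hw h2, ?_⟩
    refine Finset.card_lt_card (Finset.ssubset_iff_of_subset ?_ |>.2 ⟨s(v, w), ?_, ?_⟩)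
    · intro e he
      simp only [Finset.mem_symmDiff, Finset.mem_insert] at he ⊢
      grind
    · simp [Finset.mem_symmDiff, h1, h2]
    · simp [Finset.mem_symmDiff, h1]
  · obtain ⟨w, hw, h1, h2⟩ := key F F' hF (by omega)
    refine ⟨F.erase s(v, w), (Finset.erase_subset _ _).trans hF, w, hw, incDeg_erase hw h1, ?_⟩
    refine Finset.card_lt_card (Finset.ssubset_iff_of_subset ?_ |>.2 ⟨s(v, w), ?_, ?_⟩)
    · intro e he
      simp only [Finset.mem_symmDiff, Finset.mem_erase] at he ⊢
      grind
    · simp [Finset.mem_symmDiff, h1, h2]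
    · simp [Finset.mem_symmDiff, h2]

/-- Between two members of `A` there are no two consecutive integers missing from `A`. -/
def HasUnitGaps (A : Finset ℤ) : Prop :=
  ∀ a ∈ A, ∀ b ∈ A, ∀ i, a ≤ i → i ≤ b → i ∉ A → i + 1 ∈ A

theorem HasUnitGaps.sub_mem {A : Finset ℤ} (hA : HasUnitGaps A) {a b σ : ℤ}
    (hσ : σ = 1 ∨ σ = -1) (ha : a ∈ A) (hb : b ∈ A) (hlt : σ * b < σ * a) (h : a - σ ∉ A) :
    a - 2 * σ ∈ A ∧ σ * b < σ * (a - σ) := by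
  have hne : b ≠ a - σ := fun e => h (e ▸ hb)
  rcases hσ with rfl | rfl
  · refine ⟨by_contra fun h2 => h ?_, by omega⟩
    have := hA b hb a ha _ (by omega) (by omega) h2
    rwa [show a - 2 * 1 + 1 = a - 1 by ring] at this
  · refine ⟨?_, by omega⟩
    have := hA a ha b hb (a - -1) (by omega) (by omega) h
    rwa [show a - -1 + 1 = a - 2 * -1 by ring] at this

/-- The vectors `d_F - h` with `F ⊆ E` and `h x ∈ H x` for all `x`. -/
def degreeSystem (E : Finset (Sym2 V)) (H : V → Finset ℤ) : Set (V → ℤ) :=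
  {z | ∃ F ⊆ E, ∀ x, incDeg F x - z x ∈ H x}

variable [Fintype V]

/-- Write `z = d_F - h` and `q = d_F' - h'`. Either the degree at `v` lags behind and an edge at `v`
is toggled, or `h v` moves towards `h' v`, by two if a gap is met. The induction is on `|F ∆ F'|`
plus the `ℓ¹`-distance of `h` and `h'`. -/
theorem isJumpSystem_degreeSystem {E : Finset (Sym2 V)} (hE : ∀ e ∈ E, ¬ e.IsDiag)
    {H : V → Finset ℤ} (hH : ∀ x, HasUnitGaps (H x)) : IsJumpSystem (degreeSystem E H) := by
  rintro z ⟨F, hF, hz⟩ q ⟨F', hF', hq⟩ v σ hσ hlt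
  induction hn : (symmDiff F F').card +
      (l1 fun x => (incDeg F x - z x) - (incDeg F' x - q x)).toNat
    using Nat.strong_induction_on generalizing F z v σ with
  | _ n ih =>
    by_cases hd : σ * incDeg F v < σ * incDeg F' v
    · obtain ⟨F₁, hF₁, w, hw, hdeg, hcard⟩ := exists_toggle hE hF hF' hσ hd
      have hsub : ∀ x, incDeg F₁ x - (z + Pi.single v σ + Pi.single w σ : V → ℤ) x =
          incDeg F x - z x := by
        intro x; rw [hdeg]; simp only [Pi.add_apply]; ring
      have hz₁ : ∀ x, incDeg F₁ x - (z + Pi.single v σ + Pi.single w σ : V → ℤ) x ∈ H x :=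
        fun x => by rw [hsub]; exact hz x
      by_cases hlt' : σ * (z + Pi.single v σ : V → ℤ) w < σ * q w
      · exact Or.inr ⟨w, σ, hσ, hlt', F₁, hF₁, hz₁⟩
      -- The side effect at `w` overshoots `q`. Undoing it is a jump from the new member, whose
      -- result is `z + Pi.single v σ` again, so the induction hypothesis gives exactly the claim.
      · have e : z + Pi.single v σ + Pi.single w σ + Pi.single w (-σ) = z + Pi.single v σ := by
          rw [Pi.single_neg]; abel
        have := ih _ (by rw [← hn]; simp only [hsub]; omega)
          (z + Pi.single v σ + Pi.single w σ) F₁ hF₁ hz₁ w (-σ) (by omega) (by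
            simp only [Pi.add_apply, Pi.single_eq_same, Pi.single_eq_of_ne hw] at hlt' ⊢
            rcases hσ with rfl | rfl <;> omega) rfl
        rwa [e] at this
    · by_cases hm : incDeg F v - z v - σ ∈ H v
      · refine Or.inl ⟨F, hF, fun x => ?_⟩
        by_cases hx : x = v
        · subst hx
          simpa [sub_sub] using hm
        · simpa [Pi.single_eq_of_ne hx] using hz x
      · obtain ⟨h1, h2⟩ := (hH v).sub_mem hσ (hz v) (hq v)
          (by rcases hσ with rfl | rfl <;> omega) hm
        have hz₁ : ∀ x, incDeg F x - (z + Pi.single v σ + Pi.single v σ : V → ℤ) x ∈ H x := by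
          intro x
          by_cases hx : x = v
          · subst hx
            simp only [Pi.add_apply, Pi.single_eq_same]
            rwa [show incDeg F x - (z x + σ + σ) = incDeg F x - z x - 2 * σ by ring]
          · simpa [Pi.single_eq_of_ne hx] using hz x
        by_cases hlt' : σ * (z + Pi.single v σ : V → ℤ) v < σ * q v
        · exact Or.inr ⟨v, σ, hσ, hlt', F, hF, hz₁⟩
        · have e : z + Pi.single v σ + Pi.single v σ + Pi.single v (-σ) = z + Pi.single v σ := by
            rw [Pi.single_neg]; abel
          have hl : l1 (fun x => (incDeg F x - (z + Pi.single v σ + Pi.single v σ : V → ℤ) x) -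
              (incDeg F' x - q x)) < l1 fun x => (incDeg F x - z x) - (incDeg F' x - q x) := by
            have e2 : (fun x => (incDeg F x - (z + Pi.single v σ + Pi.single v σ : V → ℤ) x) -
              (incDeg F' x - q x)) = (fun x => (incDeg F x - z x) - (incDeg F' x - q x)) +
                Pi.single v (-2 * σ) := by
              funext x
              by_cases hx : x = v
              · subst hx; simp; ring
              · simp [Pi.single_eq_of_ne hx]
            rw [e2, l1_add_single]
            rcases hσ with rfl | rfl <;> grind
          have hl0 := l1_nonneg fun x =>
            (incDeg F x - (z + Pi.single v σ + Pi.single v σ : V → ℤ) x) - (incDeg F' x - q x)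
          have := ih _ (by omega)
            (z + Pi.single v σ + Pi.single v σ) F hF hz₁ v (-σ) (by omega) (by
              simp only [Pi.add_apply, Pi.single_eq_same] at hlt' ⊢
              rcases hσ with rfl | rfl <;> omega) rfl
          rwa [e] at this

theorem isEdgeExtension_degreeSystem {E : Finset (Sym2 V)} (hE : ∀ e ∈ E, ¬ e.IsDiag)
    {H : V → Finset ℤ} (hH : ∀ x, HasUnitGaps (H x)) {x y : V} (he : s(x, y) ∈ E) :
    IsEdgeExtension (degreeSystem (E.erase s(x, y)) H) (degreeSystem E H) x y := by
  have hyx : y ≠ x := fun h => hE _ he (by rw [h]; simp)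
  refine ⟨hyx.symm, isJumpSystem_degreeSystem
    (fun e h => hE e (Finset.mem_of_mem_erase h)) hH, isJumpSystem_degreeSystem hE hH, ?_, ?_, ?_⟩
  · rintro z ⟨F, hF, hz⟩
    exact ⟨F, hF.trans (Finset.erase_subset _ _), hz⟩
  · rintro z ⟨F, hF, hz⟩
    refine ⟨insert s(x, y) F, Finset.insert_subset he (hF.trans (Finset.erase_subset _ _)),
      fun v => ?_⟩
    rw [incDeg_insert hyx fun h => Finset.notMem_erase _ _ (hF h)]
    have := hz v
    rw [shift, add_assoc, Pi.add_apply z, add_sub_add_right_eq_sub]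
    exact this
  · rintro z ⟨F, hF, hz⟩
    by_cases h : s(x, y) ∈ F
    · right
      refine ⟨F.erase s(x, y), Finset.erase_subset_erase _ hF, fun v => ?_⟩
      rw [incDeg_erase hyx h, shift, add_assoc, Pi.add_apply z, add_sub_add_right_eq_sub]
      exact hz v
    · left
      exact ⟨F, fun e h' => Finset.mem_erase.2 ⟨fun h'' => h (h'' ▸ h'), hF h'⟩, hz⟩

end DegreeSystem

/-! ### Moving a vertex into `S` or `T` -/

section Reduction

open scoped Classical

variable {V : Type*} [Fintype V]

/-- The edges of `G - S - T`. -/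
noncomputable def edgesOff (G : SimpleGraph V) (S T : Finset V) : Finset (Sym2 V) :=
  Finset.univ.filter fun e => e ∈ G.edgeSet ∧ ∀ x ∈ e, x ∉ S ∧ x ∉ T

theorem mk_mem_edgesOff {G : SimpleGraph V} {S T : Finset V} {x y : V} :
    s(x, y) ∈ edgesOff G S T ↔ G.Adj x y ∧ (x ∉ S ∧ x ∉ T) ∧ (y ∉ S ∧ y ∉ T) := by
  simp [edgesOff]

theorem not_isDiag_of_mem_edgesOff {G : SimpleGraph V} {S T : Finset V} :
    ∀ e ∈ edgesOff G S T, ¬ e.IsDiag := by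
  intro e he
  exact G.not_isDiag_of_mem_edgeSet (Finset.mem_filter.1 he).2.1

/-- The prescription on `G - S - T`, extended by `{0}` to `S` and `T`. -/
noncomputable def reducedH (G : SimpleGraph V) (H : V → Finset ℤ) (S T : Finset V) (x : V) :
    Finset ℤ :=
  if x ∈ S ∨ x ∈ T then {0} else modified G H T x

/-- The degree system of `G - S - T` with the reduced prescription. -/
noncomputable def reducedSystem (G : SimpleGraph V) (H : V → Finset ℤ) (S T : Finset V) :
    Set (V → ℤ) :=
  degreeSystem (edgesOff G S T) (reducedH G H S T)

/-- The part of `lovaszValue` that does not involve components. -/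
noncomputable def weight (G : SimpleGraph V) (H : V → Finset ℤ) (hne : ∀ x, (H x).Nonempty)
    (S T : Finset V) : ℤ :=
  - ∑ x ∈ T, degDelete G S x - ∑ x ∈ S, maxH H hne x + ∑ x ∈ T, minH H hne x

theorem mem_modified {G : SimpleGraph V} {H : V → Finset ℤ} {T : Set V} {x : V} {i : ℤ} :
    i ∈ modified G H T x ↔ i + edgesTo G x T ∈ H x := by
  simp [modified, sub_eq_iff_eq_add]

theorem hasUnitGaps_reducedH {G : SimpleGraph V} {H : V → Finset ℤ} {hne : ∀ x, (H x).Nonempty}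
    (hgap : GapOne H hne) (S T : Finset V) (x : V) : HasUnitGaps (reducedH G H S T x) := by
  unfold reducedH
  split_ifs
  · intro a ha b hb i h1 h2 h3
    simp only [Finset.mem_singleton] at *
    omega
  · intro a ha b hb i h1 h2 h3
    rw [mem_modified] at *
    have := hgap x (i + edgesTo G x T) ((Finset.min'_le _ _ ha).trans (by linarith))
      (le_trans (by linarith) (Finset.le_max' _ _ hb)) h3
    rwa [add_right_comm] at this

theorem reducedH_nonempty {G : SimpleGraph V} {H : V → Finset ℤ} (hne : ∀ x, (H x).Nonempty)
    (S T : Finset V) (x : V) : (reducedH G H S T x).Nonempty := by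
  unfold reducedH
  split_ifs
  · exact Finset.singleton_nonempty _
  · exact (hne x).image _

theorem reducedSystem_nonempty {G : SimpleGraph V} {H : V → Finset ℤ}
    (hne : ∀ x, (H x).Nonempty) (S T : Finset V) : (reducedSystem G H S T).Nonempty := by
  choose h hh using reducedH_nonempty (G := G) hne S T
  exact ⟨fun x => incDeg ∅ x - h x, ∅, Finset.empty_subset _, fun x => by simpa using hh x⟩

theorem incDeg_eq_ncard (F : Finset (Sym2 V)) (x : V) :
    incDeg F x = ({y | s(x, y) ∈ F}.ncard : ℤ) := by
  unfold incDeg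
  have : ((F.filter fun e => x ∈ e : Finset (Sym2 V)) : Set (Sym2 V)) =
      (fun y => s(x, y)) '' {y | s(x, y) ∈ F} := by
    ext e
    simp only [Finset.coe_filter, Set.mem_ofPred_eq, Set.mem_image]
    constructor
    · rintro ⟨h1, h2⟩
      obtain ⟨y, rfl⟩ := Sym2.mem_iff_exists.1 h2
      exact ⟨y, h1, rfl⟩
    · rintro ⟨y, h1, rfl⟩
      exact ⟨h1, by simp⟩
  rw [← Set.ncard_coe_finset, this, Set.ncard_image_of_injective]
  intro a b hab
  have : a = b ∨ x = b ∧ a = x := by simpa using hab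
  rcases this with h | ⟨h1, h2⟩
  · exact h
  · exact h2.trans h1

theorem incDeg_eq_sum (F : Finset (Sym2 V)) (x : V) :
    incDeg F x = ∑ y, if s(x, y) ∈ F then (1 : ℤ) else 0 := by
  rw [incDeg_eq_ncard, Set.ncard_eq_toFinset_card', Finset.sum_boole]
  simp

theorem incDeg_eq_zero {G : SimpleGraph V} {S T : Finset V} {F : Finset (Sym2 V)}
    (hF : F ⊆ edgesOff G S T) {x : V} (hx : x ∈ S ∨ x ∈ T) : incDeg F x = 0 := by
  unfold incDeg
  rw [Finset.filter_false_of_mem]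
  · simp
  · intro e he hxe
    have := (Finset.mem_filter.1 (hF he)).2.2 x hxe
    tauto

theorem apply_eq_zero_of_mem_reducedSystem {G : SimpleGraph V} {H : V → Finset ℤ}
    {S T : Finset V} {z : V → ℤ} (hz : z ∈ reducedSystem G H S T) {x : V}
    (hx : x ∈ S ∨ x ∈ T) : z x = 0 := by
  obtain ⟨F, hF, h⟩ := hz
  have := h x
  rw [incDeg_eq_zero hF hx, reducedH, if_pos hx] at this
  simpa using this

theorem incDeg_edgesOff {G : SimpleGraph V} {S T : Finset V} (hd : Disjoint S T) {x : V}
    (hxS : x ∉ S) (hxT : x ∉ T) :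
    incDeg (edgesOff G S T) x = degDelete G S x - edgesTo G x T := by
  rw [incDeg_eq_ncard, degDelete, edgesTo, eq_sub_iff_add_eq]
  norm_cast
  rw [← Set.ncard_union_eq]
  · congr 1
    ext y
    have : y ∈ S → y ∉ T := fun h => Finset.disjoint_left.1 hd h
    simp only [mk_mem_edgesOff, Set.mem_union, Set.mem_ofPred_eq, Set.mem_inter_iff,
      SimpleGraph.mem_neighborSet, Set.mem_sdiff, Finset.mem_coe]
    tauto
  · rw [Set.disjoint_left]
    intro y
    simp only [mk_mem_edgesOff, Set.mem_ofPred_eq, Set.mem_inter_iff, Finset.mem_coe]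
    tauto

theorem weight_insert_left {G : SimpleGraph V} {H : V → Finset ℤ} (hne : ∀ x, (H x).Nonempty)
    {S T : Finset V} {x : V} (hxS : x ∉ S) :
    weight G H hne (insert x S) T = weight G H hne S T - maxH H hne x + edgesTo G x T := by
  have key : ∀ y, degDelete G (insert x S : Finset V) y =
      degDelete G S y - if G.Adj x y then 1 else 0 := by
    intro y
    unfold degDelete
    have e : G.neighborSet y \ ((insert x S : Finset V) : Set V) =
        (G.neighborSet y \ (S : Set V)) \ {x} := by
      ext w; simp; tauto
    rw [e]
    split_ifs with h
    · have hm : x ∈ G.neighborSet y \ (S : Set V) := ⟨h.symm, by simpa using hxS⟩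
      rw [← Set.ncard_sdiff_singleton_add_one hm]
      simp
    · rw [Set.sdiff_singleton_eq_self (fun hm => h hm.1.symm)]
      simp
  have h2 : edgesTo G x T = ∑ y ∈ T, if G.Adj x y then (1 : ℤ) else 0 := by
    rw [Finset.sum_boole, edgesTo, ← Set.ncard_coe_finset]
    congr 2
    ext y
    simp [and_comm]
  unfold weight
  rw [Finset.sum_insert hxS, h2, Finset.sum_congr rfl fun y _ => key y, Finset.sum_sub_distrib]
  ring

theorem weight_insert_right {G : SimpleGraph V} {H : V → Finset ℤ} (hne : ∀ x, (H x).Nonempty)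
    {S T : Finset V} {x : V} (hxT : x ∉ T) :
    weight G H hne S (insert x T) = weight G H hne S T - degDelete G S x + minH H hne x := by
  unfold weight
  rw [Finset.sum_insert hxT, Finset.sum_insert hxT]
  ring

theorem edgesTo_insert {G : SimpleGraph V} {T : Finset V} {x : V} (hxT : x ∉ T) (v : V) :
    edgesTo G v (insert x T : Finset V) = edgesTo G v T + if G.Adj x v then 1 else 0 := by
  unfold edgesTo
  rw [Finset.coe_insert]
  split_ifs with h
  · rw [Set.inter_insert_of_mem (show x ∈ G.neighborSet v from h.symm),
      Set.ncard_insert_of_notMem (by simp [hxT])]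
    push_cast
    rfl
  · rw [Set.inter_insert_of_notMem fun h' : x ∈ G.neighborSet v => h h'.symm, add_zero]

theorem edgesOff_insert_left (G : SimpleGraph V) (S T : Finset V) (x : V) :
    edgesOff G (insert x S) T = (edgesOff G S T).filter fun e => x ∉ e := by
  ext e
  simp only [edgesOff, Finset.mem_filter, Finset.mem_univ, true_and, Finset.mem_insert]
  grind

theorem edgesOff_insert_right (G : SimpleGraph V) (S T : Finset V) (x : V) :
    edgesOff G S (insert x T) = (edgesOff G S T).filter fun e => x ∉ e := by
  ext e
  simp only [edgesOff, Finset.mem_filter, Finset.mem_univ, true_and, Finset.mem_insert]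
  grind

theorem reducedH_insert_left (G : SimpleGraph V) (H : V → Finset ℤ) (S T : Finset V) {x v : V}
    (hv : v ≠ x) : reducedH G H (insert x S) T v = reducedH G H S T v := by
  simp [reducedH, hv]

theorem mem_reducedH_insert_right {G : SimpleGraph V} {H : V → Finset ℤ} {S T : Finset V}
    {x v : V} (hxS : x ∉ S) (hxT : x ∉ T) (hv : v ≠ x) (i : ℤ) :
    i ∈ reducedH G H S (insert x T) v ↔
      i + (if s(x, v) ∈ edgesOff G S T then 1 else 0) ∈ reducedH G H S T v := by
  unfold reducedH
  by_cases h : v ∈ S ∨ v ∈ T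
  · have h' : s(x, v) ∉ edgesOff G S T := by rw [mk_mem_edgesOff]; tauto
    simp [hv, h, h']
  · have h' : (s(x, v) ∈ edgesOff G S T) = G.Adj x v := by
      rw [mk_mem_edgesOff, eq_iff_iff]; tauto
    rw [if_neg (by simpa [hv] using h), if_neg h, mem_modified, mem_modified,
      edgesTo_insert hxT]
    simp only [h']
    rw [add_right_comm, add_assoc]

theorem incDeg_filter_notMem (F : Finset (Sym2 V)) {x v : V} (hv : v ≠ x) :
    incDeg (F.filter fun e => x ∉ e) v = incDeg F v - if s(x, v) ∈ F then 1 else 0 := by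
  rw [incDeg_eq_sum, incDeg_eq_sum, eq_sub_iff_add_eq,
    ← Finset.sum_erase_add _ _ (Finset.mem_univ x),
    ← Finset.sum_erase_add (a := x) _ (fun y => if s(v, y) ∈ F then (1 : ℤ) else 0)
      (Finset.mem_univ x)]
  congr 1
  · rw [if_neg (by simp), add_zero]
    refine Finset.sum_congr rfl fun y hy => ?_
    have := (Finset.ne_of_mem_erase hy).symm
    simp [hv.symm, this]
  · rw [Sym2.eq_swap]

theorem incDeg_filter_notMem_self (F : Finset (Sym2 V)) (x : V) :
    incDeg (F.filter fun e => x ∉ e) x = 0 := by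
  unfold incDeg
  rw [Finset.filter_filter, Finset.filter_false_of_mem]
  · simp
  · tauto

theorem mem_reducedH_iff {G : SimpleGraph V} {H : V → Finset ℤ} {S T : Finset V} {x : V}
    (hxS : x ∉ S) (hxT : x ∉ T) (i : ℤ) :
    i ∈ reducedH G H S T x ↔ i + edgesTo G x T ∈ H x := by
  rw [reducedH, if_neg (by tauto), mem_modified]

/-- Delete the edges of `F` at `x`. The other entries grow by at most `incDeg F x` in total, and the
entry at `x` is lost; the weight pays for this because the value prescribed at `x` is at most
`maxH`. -/
theorem exists_mem_reducedSystem_insert_left {G : SimpleGraph V} {H : V → Finset ℤ}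
    (hne : ∀ x, (H x).Nonempty) {S T : Finset V} {x : V} (hxS : x ∉ S) (hxT : x ∉ T) {z : V → ℤ}
    (hz : z ∈ reducedSystem G H S T) : ∃ q ∈ reducedSystem G H (insert x S) T,
      l1 q + weight G H hne (insert x S) T ≤ l1 z + weight G H hne S T := by
  obtain ⟨F, hF, hz⟩ := hz
  let q : V → ℤ := fun v => if v = x then 0 else z v - if s(x, v) ∈ F then 1 else 0
  refine ⟨q, ⟨F.filter fun e => x ∉ e, ?_, fun v => ?_⟩, ?_⟩
  · rw [edgesOff_insert_left]
    exact Finset.filter_subset_filter _ hF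
  · by_cases hv : v = x
    · subst hv
      simp [incDeg_filter_notMem_self, q, reducedH]
    · rw [reducedH_insert_left _ _ _ _ hv, incDeg_filter_notMem _ hv]
      have := hz v
      simp only [q, if_neg hv]
      rwa [sub_sub_sub_cancel_right]
  · have h1 : l1 q ≤ l1 z - |z x| + incDeg F x := by
      rw [incDeg_eq_sum]
      unfold l1
      rw [← Finset.sum_erase_add _ _ (Finset.mem_univ x),
        ← Finset.sum_erase_add (a := x) _ (fun x => |z x|) (Finset.mem_univ x),
        ← Finset.sum_erase_add (a := x) _ (fun y => if s(x, y) ∈ F then (1 : ℤ) else 0)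
          (Finset.mem_univ x), add_sub_cancel_right, ← add_assoc, ← Finset.sum_add_distrib]
      have h0 : |q x| = 0 := by simp [q]
      rw [h0]
      refine add_le_add (Finset.sum_le_sum fun y hy => ?_) (by split_ifs <;> norm_num)
      simp only [q, if_neg (Finset.ne_of_mem_erase hy)]
      split_ifs
      · exact abs_sub _ _
      · simp
    have h2 : incDeg F x - z x + edgesTo G x T ≤ maxH H hne x :=
      Finset.le_max' _ _ ((mem_reducedH_iff hxS hxT _).1 (hz x))
    have h3 := le_abs_self (z x)
    rw [weight_insert_left hne hxS]
    linarith

/-- Deleting the edges at `x` and lowering the prescriptions of all neighbours cancel along edges of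
`F`. Only the unused edges at `x` cost a unit, and `minH` bounds the value prescribed at `x` from
below. -/
theorem exists_mem_reducedSystem_insert_right {G : SimpleGraph V} {H : V → Finset ℤ}
    (hne : ∀ x, (H x).Nonempty) {S T : Finset V} (hd : Disjoint S T) {x : V} (hxS : x ∉ S)
    (hxT : x ∉ T) {z : V → ℤ}
    (hz : z ∈ reducedSystem G H S T) : ∃ q ∈ reducedSystem G H S (insert x T),
      l1 q + weight G H hne S (insert x T) ≤ l1 z + weight G H hne S T := by
  obtain ⟨F, hF, hz⟩ := hz
  let q : V → ℤ := fun v => if v = x then 0 else z v - (if s(x, v) ∈ F then 1 else 0) +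
    if s(x, v) ∈ edgesOff G S T then 1 else 0
  refine ⟨q, ⟨F.filter fun e => x ∉ e, ?_, fun v => ?_⟩, ?_⟩
  · rw [edgesOff_insert_right]
    exact Finset.filter_subset_filter _ hF
  · by_cases hv : v = x
    · subst hv
      simp [incDeg_filter_notMem_self, q, reducedH]
    · rw [mem_reducedH_insert_right hxS hxT hv, incDeg_filter_notMem _ hv]
      have := hz v
      simp only [q, if_neg hv]
      convert this using 1
      ring
  · have h1 : l1 q ≤ l1 z - |z x| + (incDeg (edgesOff G S T) x - incDeg F x) := by
      rw [incDeg_eq_sum, incDeg_eq_sum, ← Finset.sum_sub_distrib]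
      unfold l1
      rw [← Finset.sum_erase_add _ _ (Finset.mem_univ x),
        ← Finset.sum_erase_add (a := x) _ (fun x => |z x|) (Finset.mem_univ x),
        ← Finset.sum_erase_add (a := x) (f := fun y => (if s(x, y) ∈ edgesOff G S T then (1 : ℤ)
          else 0) - if s(x, y) ∈ F then (1 : ℤ) else 0) _ (Finset.mem_univ x),
        add_sub_cancel_right, ← add_assoc, ← Finset.sum_add_distrib]
      have h0 : |q x| = 0 := by simp [q]
      rw [h0]
      refine add_le_add (Finset.sum_le_sum fun y hy => ?_) ?_
      · simp only [q, if_neg (Finset.ne_of_mem_erase hy)]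
        have hsub := @hF s(x, y)
        split_ifs with h3 h4 h4
        · simp
        · exact absurd (hsub h3) h4
        · simpa using abs_add_le (z y) 1
        · simp
      · have hsub := @hF s(x, x)
        split_ifs <;> simp_all
    have h2 : minH H hne x ≤ incDeg F x - z x + edgesTo G x T :=
      Finset.min'_le _ _ ((mem_reducedH_iff hxS hxT _).1 (hz x))
    have h3 := neg_abs_le (z x)
    rw [weight_insert_right hne hxT]
    rw [incDeg_edgesOff hd hxS hxT] at h1
    linarith

/-- Put `x` back with no edges of `F` and with the largest prescribed value. -/
theorem exists_mem_reducedSystem_of_insert_left {G : SimpleGraph V} {H : V → Finset ℤ}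
    (hne : ∀ x, (H x).Nonempty) {S T : Finset V} {x : V} (hxS : x ∉ S) (hxT : x ∉ T) {q : V → ℤ}
    (hq : q ∈ reducedSystem G H (insert x S) T) : ∃ p ∈ reducedSystem G H S T,
      p x = edgesTo G x T - maxH H hne x ∧ l1 p = l1 q + |p x| := by
  have hqx : q x = 0 := apply_eq_zero_of_mem_reducedSystem hq (by simp)
  obtain ⟨F, hF, hq⟩ := hq
  have hFx : incDeg F x = 0 := incDeg_eq_zero hF (by simp)
  refine ⟨q + Pi.single x (edgesTo G x T - maxH H hne x), ⟨F, ?_, fun v => ?_⟩, ?_, ?_⟩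
  · rw [edgesOff_insert_left] at hF
    exact hF.trans (Finset.filter_subset _ _)
  · by_cases hv : v = x
    · subst hv
      rw [mem_reducedH_iff hxS hxT]
      simp only [Pi.add_apply, Pi.single_eq_same, hqx, hFx]
      convert Finset.max'_mem (H v) (hne v) using 1
      unfold maxH
      ring
    · rw [← reducedH_insert_left G H S T hv]
      simpa [Pi.single_eq_of_ne hv] using hq v
  · simp [hqx]
  · rw [l1_add_single]
    simp [hqx]

/-- Put `x` back with all its edges in `G - S - T` and with the least prescribed value; the added
edges offset the prescriptions of the neighbours. -/
theorem exists_mem_reducedSystem_of_insert_right {G : SimpleGraph V} {H : V → Finset ℤ}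
    (hne : ∀ x, (H x).Nonempty) {S T : Finset V} (hd : Disjoint S T) {x : V} (hxS : x ∉ S)
    (hxT : x ∉ T) {q : V → ℤ} (hq : q ∈ reducedSystem G H S (insert x T)) :
    ∃ p ∈ reducedSystem G H S T, p x = degDelete G S x - minH H hne x ∧ l1 p = l1 q + |p x| := by
  have hqx : q x = 0 := apply_eq_zero_of_mem_reducedSystem hq (by simp)
  obtain ⟨F, hF, hq⟩ := hq
  rw [edgesOff_insert_right] at hF
  set E := edgesOff G S T with hE
  have hu : ∀ v y, s(v, y) ∈ F ∪ E.filter (fun e => x ∈ e) ↔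
      s(v, y) ∈ F ∨ (s(v, y) ∈ E ∧ (x = v ∨ x = y)) := by
    intro v y; simp
  have hFx : ∀ y, s(x, y) ∉ F := fun y h => (Finset.mem_filter.1 (hF h)).2 (by simp)
  refine ⟨q + Pi.single x (degDelete G S x - minH H hne x), ⟨F ∪ E.filter fun e => x ∈ e,
    Finset.union_subset (hF.trans (Finset.filter_subset _ _)) (Finset.filter_subset _ _),
    fun v => ?_⟩, ?_, ?_⟩
  · by_cases hv : v = x
    · subst hv
      rw [mem_reducedH_iff hxS hxT]
      have : incDeg (F ∪ E.filter fun e => v ∈ e) v = incDeg E v := by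
        rw [incDeg_eq_sum, incDeg_eq_sum]
        simp only [hu, hFx, true_or, and_true, false_or]
      rw [this, incDeg_edgesOff hd hxS hxT]
      simp only [Pi.add_apply, Pi.single_eq_same, hqx]
      convert Finset.min'_mem (H v) (hne v) using 1
      unfold minH
      ring
    · have : incDeg (F ∪ E.filter fun e => x ∈ e) v =
          incDeg F v + if s(x, v) ∈ E then 1 else 0 := by
        rw [incDeg_eq_sum, incDeg_eq_sum, ← Finset.sum_erase_add _ _ (Finset.mem_univ x),
          ← Finset.sum_erase_add (a := x) _ (fun y => if s(v, y) ∈ F then (1 : ℤ) else 0)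
            (Finset.mem_univ x), add_assoc]
        congr 1
        · refine Finset.sum_congr rfl fun y hy => ?_
          have := (Finset.ne_of_mem_erase hy).symm
          simp only [hu, Ne.symm hv, this, or_self, and_false, or_false]
        · have h1 : s(v, x) ∉ F := by rw [Sym2.eq_swap]; exact hFx v
          rw [if_neg h1, zero_add]
          simp only [hu, h1, or_true, and_true, false_or]
          rw [Sym2.eq_swap]
      have h2 := (mem_reducedH_insert_right hxS hxT hv _).1 (hq v)
      rw [this]
      simp only [Pi.add_apply, Pi.single_eq_of_ne hv, add_zero]
      convert h2 using 1
      ring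
  · simp [hqx]
  · rw [l1_add_single]
    simp [hqx]

end Reduction

/-! ### The least norm and the components without factor -/

section Components

open scoped Classical

variable {V : Type*} [Fintype V]

theorem deg_eq_ncard_image {W : Type*} (F : SimpleGraph W) (u : W) {f : W → V}
    (hf : f.Injective) : deg F u = ((f '' F.neighborSet u).ncard : ℤ) := by
  rw [deg, Set.ncard_image_of_injective _ hf]

/-- Edges of `G - S - T` at a vertex of `K` stay in `K`, so `F` may be arbitrary elsewhere. This
lets all components be handled on the common vertex set `V`. -/
theorem hasFactor_component_iff {G : SimpleGraph V} {H : V → Finset ℤ} {S T : Finset V}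
    (K : (deleted G (S : Set V) (T : Set V)).ConnectedComponent) :
    HasFactor K.toSimpleGraph (modifiedOn G H S T K) ↔
      ∃ F ⊆ edgesOff G S T, ∀ u : K, incDeg F u.1.1 ∈ modified G H T u.1.1 := by
  have hinj : Function.Injective fun u : K => u.1.1 :=
    Subtype.val_injective.comp Subtype.val_injective
  have hout : ∀ u : K, u.1.1 ∉ S ∧ u.1.1 ∉ T := fun u => by
    have := u.1.2
    simpa using this
  constructor
  · rintro ⟨F, hF, hdeg⟩
    refine ⟨Finset.univ.filter fun e => ∃ a b : K, F.Adj a b ∧ s(a.1.1, b.1.1) = e,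
      fun e he => ?_, fun u => ?_⟩
    · obtain ⟨a, b, hab, rfl⟩ := (Finset.mem_filter.1 he).2
      rw [mk_mem_edgesOff]
      exact ⟨hF hab, hout a, hout b⟩
    · suffices e : {y | s(u.1.1, y) ∈ Finset.univ.filter fun e => ∃ a b : K, F.Adj a b ∧
          s(a.1.1, b.1.1) = e} = (fun u : K => u.1.1) '' F.neighborSet u by
        rw [incDeg_eq_ncard, e, ← deg_eq_ncard_image F u hinj]
        exact hdeg u
      ext y
      simp only [Finset.mem_filter, Finset.mem_univ, true_and, Set.mem_ofPred_eq, Set.mem_image,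
        SimpleGraph.mem_neighborSet]
      constructor
      · rintro ⟨a, b, hab, he⟩
        rcases Sym2.eq_iff.1 he with ⟨h1, h2⟩ | ⟨h1, h2⟩
        · exact ⟨b, hinj h1 ▸ hab, h2⟩
        · exact ⟨a, hinj h2 ▸ hab.symm, h1⟩
      · rintro ⟨b, hab, rfl⟩
        exact ⟨u, b, hab, rfl⟩
  · rintro ⟨F, hF, hdeg⟩
    let F' : SimpleGraph K :=
      { Adj := fun a b => s(a.1.1, b.1.1) ∈ F
        symm := ⟨fun a b h => by rwa [Sym2.eq_swap]⟩
        loopless := ⟨fun a h => not_isDiag_of_mem_edgesOff _ (hF h) (by simp)⟩ }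
    refine ⟨F', fun a b hab => (mk_mem_edgesOff.1 (hF hab)).1, fun u => ?_⟩
    suffices e : (fun u : K => u.1.1) '' F'.neighborSet u = {y | s(u.1.1, y) ∈ F} by
      rw [deg_eq_ncard_image F' u hinj, e, ← incDeg_eq_ncard]
      exact hdeg u
    ext y
    simp only [Set.mem_ofPred_eq, Set.mem_image, SimpleGraph.mem_neighborSet]
    constructor
    · rintro ⟨b, hab, rfl⟩
      exact hab
    · intro hy
      obtain ⟨hadj, -, hy'⟩ := mk_mem_edgesOff.1 (hF hy)
      have hyc : y ∈ ((S : Set V) ∪ T)ᶜ := by simpa using hy'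
      have hK : (⟨y, hyc⟩ : ↥((S : Set V) ∪ T)ᶜ) ∈ K.supp :=
        K.mem_supp_of_adj_mem_supp u.2 hadj
      exact ⟨⟨_, hK⟩, hy, rfl⟩

theorem tau_le_l1 {G : SimpleGraph V} {H : V → Finset ℤ} {S T : Finset V} {z : V → ℤ}
    (hz : z ∈ reducedSystem G H S T) : tau G H S T ≤ l1 z := by
  obtain ⟨F, hF, hz⟩ := hz
  have hex : ∀ K : (deleted G (S : Set V) (T : Set V)).ConnectedComponent,
      ¬ HasFactor K.toSimpleGraph (modifiedOn G H S T K) → ∃ u : K, z u.1.1 ≠ 0 := by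
    intro K hK
    by_contra! hzero
    refine hK ((hasFactor_component_iff K).2 ⟨F, hF, fun u => ?_⟩)
    have h := hz u.1.1
    have hu := u.1.2
    rwa [hzero u, sub_zero, reducedH, if_neg (by simpa using hu)] at h
  have hcard : {K : (deleted G (S : Set V) (T : Set V)).ConnectedComponent |
      ¬ HasFactor K.toSimpleGraph (modifiedOn G H S T K)}.ncard ≤
      {a : ↥((S : Set V) ∪ T)ᶜ | z a ≠ 0}.ncard := by
    refine Set.ncard_le_ncard_of_injOn
      (fun K => if h : ∃ u : K, z u.1.1 ≠ 0 then h.choose.1 else K.out) ?_ ?_ (Set.toFinite _)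
    · intro K hK
      have h := hex K hK
      simp only [dif_pos h]
      exact h.choose_spec
    · intro K hK L hL hKL
      have h := hex K hK
      have h' := hex L hL
      simp only [dif_pos h, dif_pos h'] at hKL
      have e1 : SimpleGraph.connectedComponentMk _ h.choose.1 = K := h.choose.2
      have e2 : SimpleGraph.connectedComponentMk _ h'.choose.1 = L := h'.choose.2
      rw [← e1, ← e2, hKL]
  have hsum : ({a : ↥((S : Set V) ∪ T)ᶜ | z a ≠ 0}.ncard : ℤ) ≤ l1 z := by
    rw [← Set.ncard_image_of_injective _ Subtype.val_injective]
    have : (Subtype.val '' {a : ↥((S : Set V) ∪ T)ᶜ | z a ≠ 0}).ncard ≤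
        (Finset.univ.filter fun x => z x ≠ 0).card := by
      rw [← Set.ncard_coe_finset]
      refine Set.ncard_le_ncard ?_ (Set.toFinite _)
      rintro _ ⟨a, ha, rfl⟩
      simpa using ha
    have h2 : ((Finset.univ.filter fun x => z x ≠ 0).card : ℤ) ≤ l1 z := by
      rw [Finset.card_filter]
      push_cast
      refine Finset.sum_le_sum fun x _ => ?_
      split_ifs with h
      · exact Int.one_le_abs h
      · exact abs_nonneg _
    exact le_trans (by exact_mod_cast this) h2
  exact le_trans (by unfold tau; exact_mod_cast hcard) hsum

/-- On a component with a factor, an optimal member vanishes. -/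
theorem apply_eq_zero_of_hasFactor {G : SimpleGraph V} {H : V → Finset ℤ} {S T : Finset V}
    {z : V → ℤ} (hz : IsOptimal (reducedSystem G H S T) z)
    {K : (deleted G (S : Set V) (T : Set V)).ConnectedComponent}
    (hK : HasFactor K.toSimpleGraph (modifiedOn G H S T K)) (u : K) : z u.1.1 = 0 := by
  obtain ⟨F', hF', hdeg⟩ := (hasFactor_component_iff K).1 hK
  obtain ⟨F, hF, hzF⟩ := hz.1
  let C : Set V := {x | ∃ u : K, u.1.1 = x}
  have hC : ∀ x y, s(x, y) ∈ edgesOff G S T → x ∈ C → y ∈ C := by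
    rintro _ y hxy ⟨u, rfl⟩
    obtain ⟨hadj, -, hy'⟩ := mk_mem_edgesOff.1 hxy
    have hyc : y ∈ ((S : Set V) ∪ T)ᶜ := by simpa using hy'
    exact ⟨⟨⟨y, hyc⟩, K.mem_supp_of_adj_mem_supp u.2 hadj⟩, rfl⟩
  have hC' : ∀ x y, s(x, y) ∈ edgesOff G S T → y ∈ C → x ∈ C := fun x y h =>
    hC y x (by rwa [Sym2.eq_swap])
  -- Exchanging `F` for the factor on `C` gives a member that vanishes there and is unchanged
  -- elsewhere.
  let q : V → ℤ := fun x => if x ∈ C then 0 else z x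
  have hq : q ∈ reducedSystem G H S T := by
    refine ⟨F'.filter (fun e => ∃ x ∈ e, x ∈ C) ∪ F.filter (fun e => ¬ ∃ x ∈ e, x ∈ C),
      Finset.union_subset ((Finset.filter_subset _ _).trans hF')
        ((Finset.filter_subset _ _).trans hF), fun x => ?_⟩
    have hmem : ∀ y, s(x, y) ∈ F'.filter (fun e => ∃ x ∈ e, x ∈ C) ∪
        F.filter (fun e => ¬ ∃ x ∈ e, x ∈ C) ↔ if x ∈ C then s(x, y) ∈ F' else s(x, y) ∈ F := by
      intro y
      have h1 := fun h : s(x, y) ∈ F => hC' x y (hF h)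
      have h2 := fun h : s(x, y) ∈ F' => hC' x y (hF' h)
      simp only [Finset.mem_union, Finset.mem_filter, Sym2.mem_iff, exists_eq_or_imp,
        exists_eq_left]
      split_ifs <;> tauto
    rw [incDeg_eq_sum]
    simp only [hmem]
    by_cases hx : x ∈ C
    · obtain ⟨u, rfl⟩ := hx
      have hu := u.1.2
      have hx : u.1.1 ∈ C := ⟨u, rfl⟩
      simp only [q, if_pos hx, sub_zero]
      rw [← incDeg_eq_sum, reducedH, if_neg (by simpa using hu)]
      exact hdeg u
    · simp only [q, if_neg hx]
      rw [← incDeg_eq_sum]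
      exact hzF x
  by_contra hne
  refine absurd (hz.2 q hq) (not_le.2 (Finset.sum_lt_sum (fun x _ => ?_)
    ⟨u.1.1, Finset.mem_univ _, ?_⟩))
  · simp only [q]
    split_ifs
    · simp
    · exact le_rfl
  · have hx : u.1.1 ∈ C := ⟨u, rfl⟩
    simp only [q, if_pos hx, abs_zero]
    exact abs_pos.2 hne

/-- If no coordinate has a fixed sign at the optimal members, then the least norm counts
components without factor. -/
theorem l1_le_tau {G : SimpleGraph V} {H : V → Finset ℤ} {hne : ∀ x, (H x).Nonempty}
    (hgap : GapOne H hne) {S T : Finset V} {z : V → ℤ}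
    (hz : IsOptimal (reducedSystem G H S T) z)
    (hsign : ∀ x, ∀ σ : ℤ, (σ = 1 ∨ σ = -1) → ∀ p, IsOptimal (reducedSystem G H S T) p →
      0 < σ * p x → ∃ u, IsOptimal (reducedSystem G H S T) u ∧ σ * u x < 0) :
    l1 z ≤ tau G H S T := by
  set J := reducedSystem G H S T with hJdef
  have hgapH := hasUnitGaps_reducedH (G := G) hgap S T
  have hJ : IsJumpSystem J := isJumpSystem_degreeSystem not_isDiag_of_mem_edgesOff hgapH
  have hmul : ∀ p, IsOptimal J p → ∀ x, ∀ σ : ℤ, (σ = 1 ∨ σ = -1) → σ * p x ≤ 1 := by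
    intro p hp x σ hσ
    by_cases h : 0 < σ * p x
    · obtain ⟨u, hu, hux⟩ := hsign x σ hσ p hp h
      exact hJ.mul_le_one hp hu hσ hux
    · omega
  have hsmall : ∀ p, IsOptimal J p → ∀ x, |p x| ≤ 1 := fun p hp x => abs_le.2
    ⟨by linarith [hmul p hp x (-1) (Or.inr rfl)], by linarith [hmul p hp x 1 (Or.inl rfl)]⟩
  have hboth : ∀ x, (∃ p, IsOptimal J p ∧ p x ≠ 0) →
      ∀ σ : ℤ, (σ = 1 ∨ σ = -1) → ∃ p, IsOptimal J p ∧ p x = σ := by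
    rintro x ⟨p, hp, hpx⟩ σ hσ
    have h1 := abs_le.1 (hsmall p hp x)
    by_cases h : p x = σ
    · exact ⟨p, hp, h⟩
    · have hpx' : p x = -σ := by omega
      obtain ⟨u, hu, hux⟩ := hsign x (-σ) (by omega) p hp
        (by rcases hσ with rfl | rfl <;> omega)
      have h2 := abs_le.1 (hsmall u hu x)
      exact ⟨u, hu, by rcases hσ with rfl | rfl <;> omega⟩
  -- Being nonzero at some optimal member spreads to neighbours, which makes every intermediate
  -- vertex available for `exclusive_trans`.
  have hwalk : ∀ a b : ↥((S : Set V) ∪ T)ᶜ, (deleted G (S : Set V) (T : Set V)).Walk a b →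
      (∃ p, IsOptimal J p ∧ p a ≠ 0) → (∃ p, IsOptimal J p ∧ p b ≠ 0) ∧ Exclusive J a b := by
    intro a b w
    induction w with
    | nil => exact fun h => ⟨h, Or.inl rfl⟩
    | @cons a c b hac _ ih =>
      intro ha
      have hE : s(a.1, c.1) ∈ edgesOff G S T := mk_mem_edgesOff.2
        ⟨hac, by simpa using a.2, by simpa using c.2⟩
      have hext := isEdgeExtension_degreeSystem not_isDiag_of_mem_edgesOff hgapH hE
      obtain ⟨p, hp, hpa⟩ := hboth a ha 1 (Or.inl rfl)
      obtain ⟨u, hu, hua⟩ := hboth a ha (-1) (Or.inr rfl)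
      have hc := hext.exists_ne_zero hsmall hp hu hpa hua
      obtain ⟨hb, hcb⟩ := ih hc
      exact ⟨hb, hJ.exclusive_trans hsmall hc (hext.exclusive hsmall (hboth a ha) (hboth c hc)) hcb⟩
  have hcard : {a : ↥((S : Set V) ∪ T)ᶜ | z a ≠ 0}.ncard ≤
      {K : (deleted G (S : Set V) (T : Set V)).ConnectedComponent |
        ¬ HasFactor K.toSimpleGraph (modifiedOn G H S T K)}.ncard := by
    refine Set.ncard_le_ncard_of_injOn
      (fun a => (deleted G (S : Set V) (T : Set V)).connectedComponentMk a) ?_ ?_ (Set.toFinite _)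
    · intro a ha hK
      exact ha (apply_eq_zero_of_hasFactor hz hK ⟨a, rfl⟩)
    · intro a ha b hb hab
      obtain ⟨w⟩ := SimpleGraph.ConnectedComponent.exact hab
      rcases (hwalk a b w ⟨z, hz, ha⟩).2 with h | h
      · exact Subtype.ext h
      · exact absurd (h z hz ha) hb
  have hsum : l1 z ≤ ({a : ↥((S : Set V) ∪ T)ᶜ | z a ≠ 0}.ncard : ℤ) := by
    rw [← Set.ncard_image_of_injective _ Subtype.val_injective]
    have : (Subtype.val '' {a : ↥((S : Set V) ∪ T)ᶜ | z a ≠ 0}) =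
        ((Finset.univ.filter fun x => z x ≠ 0 : Finset V) : Set V) := by
      ext x
      simp only [Set.mem_image, Set.mem_ofPred_eq, Finset.coe_filter, Finset.mem_univ, true_and]
      constructor
      · rintro ⟨a, ha, rfl⟩
        exact ha
      · intro hx
        refine ⟨⟨x, ?_⟩, hx, rfl⟩
        intro hST
        exact hx (apply_eq_zero_of_mem_reducedSystem hz.1 (by simpa using hST))
    rw [this, Set.ncard_coe_finset, Finset.card_filter]
    push_cast
    refine Finset.sum_le_sum fun x _ => ?_
    split_ifs with h
    · exact hsmall z hz x
    · simp [not_not.1 h]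
  exact hsum.trans (by unfold tau; exact_mod_cast hcard)

end Components

/-! ### The min-max formula -/

section MinMax

open scoped Classical

variable {V : Type*} [Fintype V]

theorem lovaszValue_eq (G : SimpleGraph V) (H : V → Finset ℤ) (hne : ∀ x, (H x).Nonempty)
    (S T : Finset V) : lovaszValue G H hne S T = tau G H S T + weight G H hne S T := by
  unfold lovaszValue weight; ring

theorem exists_mem_reducedSystem_le {G : SimpleGraph V} {H : V → Finset ℤ}
    (hne : ∀ x, (H x).Nonempty) {z : V → ℤ} (hz : z ∈ reducedSystem G H ∅ ∅) (S T : Finset V)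
    (hd : Disjoint S T) : ∃ q ∈ reducedSystem G H S T, l1 q + weight G H hne S T ≤ l1 z := by
  induction T using Finset.induction_on with
  | empty =>
    induction S using Finset.induction_on with
    | empty => exact ⟨z, hz, by simp [weight]⟩
    | insert x S hx ih =>
      obtain ⟨q, hq, h1⟩ := ih (by simp)
      obtain ⟨p, hp, h2⟩ := exists_mem_reducedSystem_insert_left hne hx (by simp) hq
      exact ⟨p, hp, h2.trans h1⟩
  | insert x T hx ih =>
    rw [Finset.disjoint_insert_right] at hd
    obtain ⟨q, hq, h1⟩ := ih hd.2
    obtain ⟨p, hp, h2⟩ := exists_mem_reducedSystem_insert_right hne hd.2 hd.1 hx hq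
    exact ⟨p, hp, h2.trans h1⟩

/-- As long as some coordinate has a fixed sign, its vertex goes to `S` (excess) or `T` (deficit)
without loss. When none is left, `l1_le_tau` applies. -/
theorem exists_le_lovaszValue {G : SimpleGraph V} {H : V → Finset ℤ} {hne : ∀ x, (H x).Nonempty}
    (hgap : GapOne H hne) {S T : Finset V} (hd : Disjoint S T) {z : V → ℤ}
    (hz : IsOptimal (reducedSystem G H S T) z) :
    ∃ S' T', Disjoint S' T' ∧ l1 z + weight G H hne S T ≤ lovaszValue G H hne S' T' := by
  induction hn : ((S ∪ T)ᶜ : Finset V).card using Nat.strong_induction_on generalizing S T z with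
  | _ n ih =>
    have hJ : IsJumpSystem (reducedSystem G H S T) :=
      isJumpSystem_degreeSystem not_isDiag_of_mem_edgesOff (hasUnitGaps_reducedH hgap S T)
    by_cases hsign : ∀ x, ∀ σ : ℤ, (σ = 1 ∨ σ = -1) →
        ∀ p, IsOptimal (reducedSystem G H S T) p → 0 < σ * p x →
          ∃ u, IsOptimal (reducedSystem G H S T) u ∧ σ * u x < 0
    · exact ⟨S, T, hd, by rw [lovaszValue_eq]; linarith [l1_le_tau hgap hz hsign]⟩
    push Not at hsign
    obtain ⟨x, σ, hσ, p, hp, hpx, hall⟩ := hsign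
    have hx : x ∉ S ∧ x ∉ T := by
      rw [← not_or]
      intro h
      rw [apply_eq_zero_of_mem_reducedSystem hp.1 h] at hpx
      simp at hpx
    have hcl : ∀ q ∈ reducedSystem G H S T, σ * q x ≤ 0 → l1 z - 2 * (σ * q x) ≤ l1 q := by
      intro q hq hqx
      rw [hz.l1_eq hp]
      exact hJ.l1_sub_le hσ hall hp hpx hq hqx
    rcases hσ with rfl | rfl
    · obtain ⟨q, hq⟩ := exists_isOptimal (reducedSystem_nonempty (G := G) hne (insert x S) T)
      have hlt : ((insert x S ∪ T)ᶜ : Finset V).card < n := by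
        rw [← hn]
        refine Finset.card_lt_card (compl_lt_compl_iff_lt.2 (Finset.ssubset_iff_of_subset ?_ |>.2
          ⟨x, by simp, by simp [hx]⟩))
        exact Finset.union_subset_union_left (Finset.subset_insert _ _)
      obtain ⟨S', T', hd', hle⟩ := ih _ hlt (by simp [hd, hx]) hq rfl
      refine ⟨S', T', hd', le_trans ?_ hle⟩
      obtain ⟨r, hr, hrx, hrl⟩ := exists_mem_reducedSystem_of_insert_left hne hx.1 hx.2 hq.1
      rw [weight_insert_left hne hx.1]
      -- The weight changes by exactly `r x`. If `r x ≤ 0`, the surplus `2 * |r x|` from `hcl`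
      -- covers both this loss and the term `|r x|` in the norm of `r`; if `r x > 0`, optimality of
      -- `z` suffices.
      rcases le_or_gt (r x) 0 with h | h
      · have := hcl r hr (by linarith)
        rw [abs_of_nonpos h] at hrl
        linarith
      · have := hz.2 r hr
        rw [abs_of_pos h] at hrl
        linarith
    · obtain ⟨q, hq⟩ := exists_isOptimal (reducedSystem_nonempty (G := G) hne S (insert x T))
      have hlt : ((S ∪ insert x T)ᶜ : Finset V).card < n := by
        rw [← hn]
        refine Finset.card_lt_card (compl_lt_compl_iff_lt.2 (Finset.ssubset_iff_of_subset ?_ |>.2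
          ⟨x, by simp, by simp [hx]⟩))
        exact Finset.union_subset_union_right (Finset.subset_insert _ _)
      obtain ⟨S', T', hd', hle⟩ := ih _ hlt (by simp [hd, hx]) hq rfl
      refine ⟨S', T', hd', le_trans ?_ hle⟩
      obtain ⟨r, hr, hrx, hrl⟩ := exists_mem_reducedSystem_of_insert_right hne hd hx.1 hx.2 hq.1
      rw [weight_insert_right hne hx.2]
      rcases le_or_gt 0 (r x) with h | h
      · have := hcl r hr (by linarith)
        rw [abs_of_nonneg h] at hrl
        linarith
      · have := hz.2 r hr
        rw [abs_of_neg h] at hrl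
        linarith

theorem reducedH_empty (G : SimpleGraph V) (H : V → Finset ℤ) : reducedH G H ∅ ∅ = H := by
  funext x
  ext i
  rw [mem_reducedH_iff (by simp) (by simp)]
  simp [edgesTo]

theorem incDeg_edgeSet (F : SimpleGraph V) (x : V) :
    incDeg (Finset.univ.filter fun e => e ∈ F.edgeSet) x = deg F x := by
  rw [incDeg_eq_ncard, deg]
  congr 2
  ext y
  simp

theorem distTo_le (d : ℤ) {A : Finset ℤ} (hA : A.Nonempty) {a : ℤ} (ha : a ∈ A) :
    distTo d A hA ≤ (d - a).natAbs :=
  Finset.inf'_le _ ha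

theorem exists_distTo_eq (d : ℤ) {A : Finset ℤ} (hA : A.Nonempty) :
    ∃ a ∈ A, distTo d A hA = (d - a).natAbs :=
  Finset.exists_mem_eq_inf' hA _

theorem distTo_eq_zero_iff (d : ℤ) {A : Finset ℤ} (hA : A.Nonempty) :
    distTo d A hA = 0 ↔ d ∈ A := by
  constructor
  · intro h
    obtain ⟨a, ha, h'⟩ := exists_distTo_eq d hA
    have : d = a := by omega
    exact this ▸ ha
  · intro h
    have := distTo_le d hA h
    simpa using this

theorem totalDeficiency_le_l1 {G : SimpleGraph V} {H : V → Finset ℤ} (hne : ∀ x, (H x).Nonempty)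
    {z : V → ℤ} (hz : z ∈ reducedSystem G H ∅ ∅) : (totalDeficiency G H hne : ℤ) ≤ l1 z := by
  obtain ⟨F, hF, hz⟩ := hz
  rw [reducedH_empty] at hz
  have hle : totalDeficiency G H hne ≤
      subgraphDeficiency H hne (SimpleGraph.fromEdgeSet (F : Set (Sym2 V))) := by
    refine Nat.sInf_le ⟨_, ?_, rfl⟩
    intro a b hab
    rw [SimpleGraph.fromEdgeSet_adj] at hab
    exact (mk_mem_edgesOff.1 (hF hab.1)).1
  have hdeg : ∀ x, deg (SimpleGraph.fromEdgeSet (F : Set (Sym2 V))) x = incDeg F x := by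
    intro x
    rw [← incDeg_edgeSet]
    congr 1
    ext e
    simp only [Finset.mem_filter, Finset.mem_univ, true_and, SimpleGraph.edgeSet_fromEdgeSet,
      Set.mem_sdiff, Finset.mem_coe]
    exact ⟨fun h => h.1, fun h => ⟨h, not_isDiag_of_mem_edgesOff e (hF h)⟩⟩
  refine le_trans (Int.ofNat_le.2 hle) ?_
  unfold subgraphDeficiency l1
  push_cast
  refine Finset.sum_le_sum fun x _ => ?_
  have := distTo_le (incDeg F x) (hne x) (hz x)
  rw [sub_sub_cancel] at this
  rw [hdeg, Int.abs_eq_natAbs]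
  exact_mod_cast this

theorem exists_l1_eq_totalDeficiency (G : SimpleGraph V) (H : V → Finset ℤ)
    (hne : ∀ x, (H x).Nonempty) :
    ∃ z ∈ reducedSystem G H ∅ ∅, l1 z = totalDeficiency G H hne := by
  obtain ⟨F, hF, hval⟩ : totalDeficiency G H hne ∈
      {n : ℕ | ∃ F : SimpleGraph V, F ≤ G ∧ n = subgraphDeficiency H hne F} :=
    Nat.sInf_mem ⟨_, ⊥, bot_le, rfl⟩
  choose h hh hd using fun x => exists_distTo_eq (deg F x) (hne x)
  refine ⟨fun x => deg F x - h x, ⟨Finset.univ.filter fun e => e ∈ F.edgeSet, ?_, fun x => ?_⟩, ?_⟩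
  · intro e he
    simp only [Finset.mem_filter, Finset.mem_univ, true_and, edgesOff, Finset.notMem_empty,
      not_false_eq_true, and_self, implies_true, and_true] at he ⊢
    exact SimpleGraph.edgeSet_mono hF he
  · rw [incDeg_edgeSet, reducedH_empty]
    simpa using hh x
  · rw [hval, l1, subgraphDeficiency]
    push_cast
    refine Finset.sum_congr rfl fun x _ => ?_
    rw [hd, Int.natCast_natAbs]

theorem isGreatest_totalDeficiency {G : SimpleGraph V} {H : V → Finset ℤ}
    {hne : ∀ x, (H x).Nonempty} (hgap : GapOne H hne) :
    IsGreatest {r : ℤ | ∃ S T : Finset V, Disjoint S T ∧ r = lovaszValue G H hne S T}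
      (totalDeficiency G H hne : ℤ) := by
  obtain ⟨z, hz, hzl⟩ := exists_l1_eq_totalDeficiency G H hne
  have hopt : IsOptimal (reducedSystem G H ∅ ∅) z :=
    ⟨hz, fun q hq => hzl ▸ totalDeficiency_le_l1 hne hq⟩
  have hub : ∀ S T : Finset V, Disjoint S T →
      lovaszValue G H hne S T ≤ totalDeficiency G H hne := by
    intro S T hd
    obtain ⟨q, hq, hle⟩ := exists_mem_reducedSystem_le hne hz S T hd
    rw [lovaszValue_eq, ← hzl]
    linarith [tau_le_l1 hq]
  constructor
  · obtain ⟨S, T, hd, hle⟩ := exists_le_lovaszValue hgap (Finset.disjoint_empty_left ∅) hopt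
    refine ⟨S, T, hd, le_antisymm ?_ (hub S T hd)⟩
    simpa [weight, hzl] using hle
  · rintro _ ⟨S, T, hd, rfl⟩
    exact hub S T hd

theorem hasFactor_iff_totalDeficiency_eq_zero (G : SimpleGraph V) (H : V → Finset ℤ)
    (hne : ∀ x, (H x).Nonempty) : HasFactor G H ↔ totalDeficiency G H hne = 0 := by
  constructor
  · rintro ⟨F, hF, hdeg⟩
    refine Nat.eq_zero_of_le_zero (Nat.sInf_le ⟨F, hF, ?_⟩)
    exact (Finset.sum_eq_zero fun x _ => (distTo_eq_zero_iff _ _).2 (hdeg x)).symm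
  · intro h
    obtain ⟨F, hF, hval⟩ : totalDeficiency G H hne ∈
        {n : ℕ | ∃ F : SimpleGraph V, F ≤ G ∧ n = subgraphDeficiency H hne F} :=
      Nat.sInf_mem ⟨_, ⊥, bot_le, rfl⟩
    rw [h] at hval
    exact ⟨F, hF, fun x => (distTo_eq_zero_iff _ (hne x)).1
      (Finset.sum_eq_zero_iff.1 hval.symm x (Finset.mem_univ x))⟩

end MinMax

end HFactor

theorem mainTheorem1 {V : Type*} [Fintype V] (G : SimpleGraph V) (H : V → Finset ℤ)
    (hnonneg : ∀ x, ∀ i ∈ H x, 0 ≤ i) (hne : ∀ x, (H x).Nonempty)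
    (hgap : HFactor.GapOne H hne) :
    IsGreatest {r : ℤ | ∃ S T : Finset V, Disjoint S T ∧ r = HFactor.lovaszValue G H hne S T}
        (HFactor.totalDeficiency G H hne : ℤ) ∧
      (HFactor.HasFactor G H ↔
        ∀ S T : Finset V, Disjoint S T → HFactor.lovaszValue G H hne S T ≤ 0) := by
  have h := HFactor.isGreatest_totalDeficiency (G := G) hgap
  refine ⟨h, ?_⟩
  rw [HFactor.hasFactor_iff_totalDeficiency_eq_zero G H hne]
  constructor
  · intro h0 S T hd
    have := h.2 ⟨S, T, hd, rfl⟩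
    rwa [h0] at this
  · intro hle
    obtain ⟨S, T, hd, heq⟩ := h.1
    have := hle S T hd
    omega
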